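/- Let $d\ge 2$ and $0<\alpha\le\beta<\infty$, and let $|\cdot|$ be the Euclidean norm on $\mathbb Z^d$. A conductivity function is a map $a:\mathbb Z^d\times\mathbb Z^d\to[0,\infty)$ with $a(x,y)=0$ if $|x-y|\neq1$ and $a(x,y)=a(y,x)\in[\alpha,\beta]$ if $|x-y|=1$. Put $\nabla u(x)=(u(x+e_i)-u(x))_{i=1}^d$ and $A(x)=\mathrm{diag}(a(x,x+e_1),\dots,a(x,x+e_d))$. For $T>0$ and $y\in\mathbb Z^d$ the discrete Green's function $G_T(\cdot,y)=G_T(\cdot,y;a)$ is the unique element of $\ell^2(\mathbb Z^d)$ with $$\sum_{x}T^{-1}G_T(x,y)v(x)+\sum_x\nabla v(x)\cdot A(x)\nabla_xG_T(x,y)=v(y)\qquad\text{for all }v\in\ell^2(\mathbb Z^d).$$ There is $R_0\ge1$ depending only on $d,\alpha,\beta$ such that the following holds. (i) For every $q\ge1$ there is $C=C(d,\alpha,\beta,q)$ such that for all conductivity functions $a$, all $T>0$, $y\in\mathbb Z^d$ and $R\ge R_0$: $$\text{if }d=2:\quad \sum_{|x-y|\le R}\bigl|G_T(x,y)-\bar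 G_T(\cdot,y)_{\{|x-y|\le R\}}\bigr|^q\le C R^2,$$ where $\bar G_T(\cdot,y)_{\{|x-y|\le R\}}$ is the average of $G_T(\cdot,y)$ over $\{x\in\mathbb Z^d:|x-y|\le R\}$; $$\text{if }d>2:\quad \sum_{R\le|x-y|\le2R}G_T(x,y)^q\le C R^d(R^{2-d})^q.$$ (ii) If $d=2$, then for all $0<c_1\le c_2$ there is $C=C(\alpha,\beta,c_1,c_2)$ such that for all $a$, $y$, all $T>0$ and all $R$ with $c_1\sqrt T\le R\le c_2\sqrt T$, $$R^{-2}\sum_{|x-y|\le R}G_T(x,y)^2\le C.$$ (iii) For all $q\ge1$ and $r\ge0$ there is $R_1=R_1(d,\alpha,\beta,q,r)\ge 1$, and for every $T_0>0$ there is $C=C(d,\alpha,\beta,q,r,T_0)$, such that for all $a$, $y$, all $T>0$ and all $R\ge\sqrt T$ with $T\ge T_0$ or $R\ge R_1$, $$\sum_{R\le|x-y|\le2R}G_T(x,y)^q\le C R^d(R^{2-d})^q\bigl(\sqrt T R^{-1}\bigr)^r.$$ -/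

import Mathlib

/-- The Euclidean length `|x|` of a point `x` of the lattice `ℤ^d`. -/
noncomputable def latticeNorm {d : ℕ} (x : Fin d → ℤ) : ℝ :=
  Real.sqrt (∑ i, (x i : ℝ) ^ 2)

/-- A conductivity function on `ℤ^d` with ellipticity constants `α` and `β`: it vanishes off the
nearest-neighbour pairs, and is symmetric with values in `[α, β]` on them. -/
structure IsConductivity {d : ℕ} (α β : ℝ) (a : (Fin d → ℤ) → (Fin d → ℤ) → ℝ) : Prop where
  eq_zero : ∀ x y, latticeNorm (x - y) ≠ 1 → a x y = 0
  symm : ∀ x y, latticeNorm (x - y) = 1 → a x y = a y x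
  mem_Icc : ∀ x y, latticeNorm (x - y) = 1 → a x y ∈ Set.Icc α β

/-- The canonical basis vector `e_i` of `ℤ^d`. -/
def latticeBasis {d : ℕ} (i : Fin d) : Fin d → ℤ := Pi.single i 1

/-- The `i`-th component of the forward discrete gradient, `∇_i u(x) = u(x + e_i) - u(x)`. -/
def latticeGrad {d : ℕ} (u : (Fin d → ℤ) → ℝ) (i : Fin d) (x : Fin d → ℤ) : ℝ :=
  u (x + latticeBasis i) - u x

/-- `u ∈ ℓ²(ℤ^d)` solves `T⁻¹ u - ∇*·A∇u = δ_y` in the weak form, tested with all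
`v ∈ ℓ²(ℤ^d)`, where `A(x) = diag(a(x, x + e_1), …, a(x, x + e_d))`. -/
structure IsGreenFunction {d : ℕ} (T : ℝ) (a : (Fin d → ℤ) → (Fin d → ℤ) → ℝ)
    (y : Fin d → ℤ) (u : (Fin d → ℤ) → ℝ) : Prop where
  memℓp : Memℓp u 2
  weak_eq : ∀ v : (Fin d → ℤ) → ℝ, Memℓp v 2 →
    ∑' x, T⁻¹ * u x * v x
      + ∑' x, ∑ i, latticeGrad v i x * (a x (x + latticeBasis i) * latticeGrad u i x) = v y

section Existence

theorem latticeNorm_basis {d : ℕ} (x : Fin d → ℤ) (i : Fin d) :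
    latticeNorm (x - (x + latticeBasis i)) = 1 := by
  have h : ∀ j, ((((x - (x + latticeBasis i)) j : ℤ) : ℝ)) ^ 2 = if j = i then 1 else 0 := by
    intro j
    by_cases hj : j = i <;> simp [latticeBasis, hj]
  simp only [latticeNorm, h]
  simp

theorem memℓp_shift {d : ℕ} {u : (Fin d → ℤ) → ℝ} (hu : Memℓp u 2) (z : Fin d → ℤ) :
    Memℓp (fun x => u (x + z)) 2 := by
  refine memℓp_gen ?_
  exact (hu.summable (by norm_num)).comp_injective (add_left_injective z)

theorem memℓp_grad {d : ℕ} {u : (Fin d → ℤ) → ℝ} (hu : Memℓp u 2) (i : Fin d) :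
    Memℓp (latticeGrad u i) 2 :=
  (memℓp_shift hu (latticeBasis i)).sub hu

theorem lp_two_norm_sq {ι : Type*} (u : lp (fun _ : ι => ℝ) 2) : ‖u‖ ^ 2 = ∑' x, u x ^ 2 := by
  rw [← real_inner_self_eq_norm_sq, lp.inner_eq_tsum]
  exact tsum_congr fun x => by simp [pow_two]

theorem lp_two_summable_mul {ι : Type*} {u v : ι → ℝ} (hu : Memℓp u 2) (hv : Memℓp v 2) :
    Summable fun x => u x * v x := by
  have h := lp.summable_inner (𝕜 := ℝ) (⟨v, hv⟩ : lp (fun _ : ι => ℝ) 2) ⟨u, hu⟩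
  simpa using h

theorem lp_two_summable_sq {ι : Type*} {u : ι → ℝ} (hu : Memℓp u 2) :
    Summable fun x => u x ^ 2 := by
  simpa [pow_two] using lp_two_summable_mul hu hu

/-- The discrete partial derivative as a bounded operator on `ℓ²(ℤ^d)`. -/
noncomputable def gradL {d : ℕ} (i : Fin d) :
    lp (fun _ : Fin d → ℤ => ℝ) 2 →L[ℝ] lp (fun _ : Fin d → ℤ => ℝ) 2 :=
  LinearMap.mkContinuous
    { toFun := fun u => ⟨latticeGrad u i, memℓp_grad (lp.memℓp u) i⟩
      map_add' := fun u v => by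
        ext x; simp only [latticeGrad, lp.coeFn_add, Pi.add_apply]; ring
      map_smul' := fun c u => by
        ext x
        simp only [latticeGrad, lp.coeFn_smul, Pi.smul_apply, smul_eq_mul, RingHom.id_apply]
        ring }
    2 (fun u => by
      have hS : ‖(⟨fun x => u (x + latticeBasis i), memℓp_shift (lp.memℓp u) _⟩ :
          lp (fun _ : Fin d → ℤ => ℝ) 2)‖ = ‖u‖ := by
        rw [← sq_eq_sq₀ (norm_nonneg _) (norm_nonneg _), lp_two_norm_sq, lp_two_norm_sq]
        exact (Equiv.addRight (latticeBasis i)).tsum_eq (fun x => u x ^ 2)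
      calc _ = ‖(⟨fun x => u (x + latticeBasis i), memℓp_shift (lp.memℓp u) _⟩ :
            lp (fun _ : Fin d → ℤ => ℝ) 2) - u‖ := rfl
        _ ≤ _ := norm_sub_le _ _
        _ = 2 * ‖u‖ := by rw [hS]; ring)

theorem gradL_apply {d : ℕ} (i : Fin d) (u : lp (fun _ : Fin d → ℤ => ℝ) 2) (x : Fin d → ℤ) :
    gradL i u x = latticeGrad u i x := rfl

theorem memℓp_bdd_mul {ι : Type*} {c u : ι → ℝ} {β : ℝ} (hc : ∀ x, |c x| ≤ β)
    (hu : Memℓp u 2) : Memℓp (fun x => c x * u x) 2 := by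
  refine memℓp_gen ?_
  have h := (lp_two_summable_sq hu).mul_left (β ^ 2)
  refine Summable.of_nonneg_of_le (fun x => by positivity) (fun x => ?_) h
  have h1 : (c x) ^ 2 ≤ β ^ 2 := sq_le_sq' (neg_le_of_abs_le (hc x)) (le_of_abs_le (hc x))
  have h2 : ‖c x * u x‖ ^ (2 : ENNReal).toReal = c x ^ 2 * u x ^ 2 := by
    simp [mul_pow]
  rw [h2]
  gcongr

/-- Multiplication by a bounded function as a bounded operator on `ℓ²`. -/
noncomputable def mulL {ι : Type*} (c : ι → ℝ) (β : ℝ) (hc : ∀ x, |c x| ≤ β) :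
    lp (fun _ : ι => ℝ) 2 →L[ℝ] lp (fun _ : ι => ℝ) 2 :=
  LinearMap.mkContinuous
    { toFun := fun u => ⟨fun x => c x * u x, memℓp_bdd_mul hc (lp.memℓp u)⟩
      map_add' := fun u v => by
        ext x; simp only [lp.coeFn_add, Pi.add_apply]; ring
      map_smul' := fun k u => by
        ext x
        simp only [lp.coeFn_smul, Pi.smul_apply, smul_eq_mul, RingHom.id_apply]
        ring }
    |β| (fun u => by
      refine abs_le_of_sq_le_sq' ?_ (by positivity) |>.2
      rw [mul_pow, lp_two_norm_sq, lp_two_norm_sq, sq_abs, ← tsum_mul_left]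
      refine Summable.tsum_le_tsum (fun x => ?_)
        (lp_two_summable_sq (memℓp_bdd_mul hc (lp.memℓp u)))
        ((lp_two_summable_sq (lp.memℓp u)).mul_left _)
      have h1 : (c x) ^ 2 ≤ β ^ 2 := sq_le_sq' (neg_le_of_abs_le (hc x)) (le_of_abs_le (hc x))
      change (c x * u x) ^ 2 ≤ _
      rw [mul_pow]
      gcongr)

theorem mulL_apply {ι : Type*} (c : ι → ℝ) (β : ℝ) (hc : ∀ x, |c x| ≤ β)
    (u : lp (fun _ : ι => ℝ) 2) (x : ι) : mulL c β hc u x = c x * u x := rfl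

/-- Existence and uniqueness of the Green's function. -/
theorem existsUnique_isGreenFunction {d : ℕ} {α β T : ℝ} (hα : 0 < α) (hT : 0 < T)
    {a : (Fin d → ℤ) → (Fin d → ℤ) → ℝ} (ha : IsConductivity α β a) (y : Fin d → ℤ) :
    ∃! u, IsGreenFunction T a y u := by
  classical
  have hpos : ∀ i x, 0 ≤ a x (x + latticeBasis i) := fun i x =>
    hα.le.trans (ha.mem_Icc _ _ (latticeNorm_basis x i)).1
  have hc : ∀ (i : Fin d) x, |a x (x + latticeBasis i)| ≤ β := fun i x => by
    rw [abs_of_nonneg (hpos i x)]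
    exact (ha.mem_Icc _ _ (latticeNorm_basis x i)).2
  let K : Fin d → _ := fun i =>
    (mulL (fun x => a x (x + latticeBasis i)) β (hc i)).comp (gradL i)
  let B : lp (fun _ : Fin d → ℤ => ℝ) 2 →L[ℝ] lp (fun _ : Fin d → ℤ => ℝ) 2 →L[ℝ] ℝ :=
    (innerSL ℝ).comp (T⁻¹ • ContinuousLinearMap.id ℝ _
      + ∑ i, (ContinuousLinearMap.adjoint (gradL i)).comp (K i))
  have hB : ∀ u v, B u v = ∑' x, T⁻¹ * u x * v x
      + ∑' x, ∑ i, latticeGrad v i x * (a x (x + latticeBasis i) * latticeGrad u i x) := by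
    intro u v
    have h1 : B u v = T⁻¹ * inner ℝ u v + ∑ i, inner ℝ (K i u) (gradL i v) := by
      simp only [B, ContinuousLinearMap.comp_apply, add_apply,
        sum_apply, innerSL_apply_apply, inner_add_left, sum_inner,
        smul_apply, ContinuousLinearMap.id_apply, real_inner_smul_left,
        ContinuousLinearMap.adjoint_inner_left]
    rw [h1, Summable.tsum_finsetSum]
    · congr 1
      · rw [lp.inner_eq_tsum, ← tsum_mul_left]
        refine tsum_congr fun x => ?_
        simp only [RCLike.inner_apply, conj_trivial]
        ring
    · intro i _
      exact lp_two_summable_mul (memℓp_grad (lp.memℓp v) i)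
        (memℓp_bdd_mul (hc i) (memℓp_grad (lp.memℓp u) i))
  have hcoer : IsCoercive B := by
    refine ⟨T⁻¹, by positivity, fun u => ?_⟩
    rw [hB]
    have h1 : T⁻¹ * ‖u‖ * ‖u‖ = ∑' x, T⁻¹ * u x * u x := by
      rw [mul_assoc, ← pow_two, lp_two_norm_sq, ← tsum_mul_left]
      exact tsum_congr fun x => by ring
    rw [h1]
    refine le_add_of_nonneg_right (tsum_nonneg fun x => Finset.sum_nonneg fun i _ => ?_)
    have h2 : latticeGrad u i x * (a x (x + latticeBasis i) * latticeGrad u i x)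
        = a x (x + latticeBasis i) * latticeGrad u i x ^ 2 := by ring
    rw [h2]
    exact mul_nonneg (hpos i x) (sq_nonneg _)
  let f : lp (fun _ : Fin d → ℤ => ℝ) 2 := lp.single 2 y (1 : ℝ)
  have hf : ∀ v : lp (fun _ : Fin d → ℤ => ℝ) 2, inner ℝ f v = v y := by
    intro v
    have := lp.inner_single_left (𝕜 := ℝ) y (1 : ℝ) v
    simpa [f] using this
  let E := hcoer.continuousLinearEquivOfBilin
  refine ⟨E.symm f, ⟨lp.memℓp _, fun v hv => ?_⟩, fun w hw => ?_⟩
  · have h := hcoer.continuousLinearEquivOfBilin_apply (E.symm f) ⟨v, hv⟩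
    rw [hB] at h
    have h2 : hcoer.continuousLinearEquivOfBilin (E.symm f) = f := E.apply_symm_apply f
    rw [h2, hf] at h
    exact h.symm
  · have h := hcoer.unique_continuousLinearEquivOfBilin (v := ⟨w, hw.memℓp⟩) (f := f)
      (fun v => by rw [hB, hf]; exact (hw.weak_eq v (lp.memℓp v)).symm)
    have h2 : E.symm f = ⟨w, hw.memℓp⟩ := by rw [h]; exact E.symm_apply_apply _
    rw [h2]

end Existence

open Classical in
/-- The discrete Green's function `G_T(x, y; a)`: as a function of `x`, the unique solution in
`ℓ²(ℤ^d)` of `T⁻¹ u - ∇*·A∇u = δ_y`. -/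
noncomputable def greenFunction {d : ℕ} (T : ℝ) (a : (Fin d → ℤ) → (Fin d → ℤ) → ℝ)
    (x y : Fin d → ℤ) : ℝ :=
  if h : ∃! u, IsGreenFunction T a y u then h.choose x else 0

/-- For `T > 0` and a conductivity function `a`, `greenFunction` is the solution. -/
theorem isGreenFunction_greenFunction {d : ℕ} {α β T : ℝ} (hα : 0 < α) (hT : 0 < T)
    {a : (Fin d → ℤ) → (Fin d → ℤ) → ℝ} (ha : IsConductivity α β a) (y : Fin d → ℤ) :
    IsGreenFunction T a y (fun x => greenFunction T a x y) := by
  have h := existsUnique_isGreenFunction hα hT ha y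
  have h2 : (fun x => greenFunction T a x y) = h.choose := by
    funext x
    simp only [greenFunction, dif_pos h]
  rw [h2]
  exact h.choose_spec.1

theorem finite_latticeBall {d : ℕ} (y : Fin d → ℤ) (R : ℝ) :
    {x : Fin d → ℤ | latticeNorm (x - y) ≤ R}.Finite := by
  refine (Set.finite_Icc (fun i => y i - ⌈R⌉) (fun i => y i + ⌈R⌉)).subset fun x hx => ?_
  have h : ∀ i, |((x i - y i : ℤ) : ℝ)| ≤ ⌈R⌉ := fun i => by
    refine le_trans ?_ ((show latticeNorm (x - y) ≤ R from hx).trans (Int.le_ceil R))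
    refine Real.abs_le_sqrt ?_
    exact Finset.single_le_sum (f := fun j => (((x - y) j : ℤ) : ℝ) ^ 2)
      (fun j _ => sq_nonneg _) (Finset.mem_univ i)
  have h' : ∀ i, |x i - y i| ≤ ⌈R⌉ := fun i => by exact_mod_cast h i
  exact ⟨fun i => by have := abs_le.1 (h' i); dsimp only; linarith,
    fun i => by have := abs_le.1 (h' i); dsimp only; linarith⟩

/-- The lattice ball `{x ∈ ℤ^d : |x - y| ≤ R}`. -/
noncomputable def latticeBall {d : ℕ} (y : Fin d → ℤ) (R : ℝ) : Finset (Fin d → ℤ) :=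
  (finite_latticeBall y R).toFinset

open Classical in
/-- The lattice annulus `{x ∈ ℤ^d : R ≤ |x - y| ≤ 2R}`. -/
noncomputable def latticeAnnulus {d : ℕ} (y : Fin d → ℤ) (R : ℝ) : Finset (Fin d → ℤ) :=
  (latticeBall y (2 * R)).filter fun x => R ≤ latticeNorm (x - y)

theorem mem_latticeBall {d : ℕ} {x y : Fin d → ℤ} {R : ℝ} :
    x ∈ latticeBall y R ↔ latticeNorm (x - y) ≤ R := by
  simp [latticeBall]

theorem mem_latticeAnnulus {d : ℕ} {x y : Fin d → ℤ} {R : ℝ} :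
    x ∈ latticeAnnulus y R ↔ R ≤ latticeNorm (x - y) ∧ latticeNorm (x - y) ≤ 2 * R := by
  simp [latticeAnnulus, mem_latticeBall, and_comm]

/-- The average of `u` over the lattice ball of radius `R` around `y`. -/
noncomputable def ballAverage {d : ℕ} (u : (Fin d → ℤ) → ℝ) (y : Fin d → ℤ) (R : ℝ) : ℝ :=
  (∑ x ∈ latticeBall y R, u x) / ((latticeBall y R).card : ℝ)

/-! Everything comes from testing the equation for $u=G_T(\cdot,y)$ with truncations of $u$. The
right-hand side is a unit point mass, so the slice of $u$ between heights $l$ and $l+k$ has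
Dirichlet energy at most $k/\alpha$, uniformly in $T$ (`IsGreenFunction.energy_clamp_le`). A
truncated substitute for the constant test function shows that the total mass is at most $T$
(`IsGreenFunction.sum_le`).

Faber-Krahn inequalities turn the slice bound into a recursion for the sizes $N(k)$ of level sets.
For $d>2$, Nash's inequality gives $kN(2k)\lesssim N(k)^{2/d}$, which forces $N(k)\lesssim
k^{-d/(d-2)}$; hence $u$ has $\ell^1$ norm $O(R^2)$ on sets of $O(R^d)$ points (`exists_sum_le_sq`).
For $d=2$ one counts instead the points of a square of side about $2R$ where $u$ differs by at least
$k$ from its median $c$. The truncations above and below $c$ vanish on half of the square, so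
$kN(2k)\lesssim N(k)$; this decays faster than any power and bounds all moments of $u-c$
(`exists_sum_abs_sub_median_le`). Replacing $c$ by the average costs a constant, and the mass bound
gives $cR^2\le 2T$, which settles the regime $R\sim\sqrt T$.

Away from $y$, $u$ and its powers $u^{2^m}$ are nonnegative subsolutions. Caccioppoli and Nash give
a reverse Hölder inequality (`exists_sum_sq_le_sum`), and finitely many Moser steps bound the
$\ell^q$ norm on an annulus by the $\ell^1$ norm on a larger one. With the $O(R^2)$ bound this is
the case $d>2$. For the decay beyond $\sqrt T$, the term $T^{-1}u$ in Caccioppoli's inequality gains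
a factor of order $T/R^2$ each time the annulus shrinks (`exists_sum_superlevel_le_decay`). -/

/-! ### Translation estimates and Nash's inequality on the lattice. -/

/-- The discrete Dirichlet energy `∑_x |∇f(x)|²`. -/
noncomputable def latticeEnergy {d : ℕ} (f : (Fin d → ℤ) → ℝ) : ℝ :=
  ∑' x, ∑ i, latticeGrad f i x ^ 2

theorem memℓp_two_of_finite_support {ι : Type*} {f : ι → ℝ} (hf : (Function.support f).Finite) :
    Memℓp f 2 := by
  refine memℓp_gen (summable_of_hasFiniteSupport (hf.subset fun x hx => ?_))
  intro h
  apply hx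
  simp [h]

theorem memℓp_two_of_abs_le {ι : Type*} {f g : ι → ℝ} (hg : Memℓp g 2) (h : ∀ x, |f x| ≤ |g x|) :
    Memℓp f 2 := by
  refine memℓp_gen ?_
  refine Summable.of_nonneg_of_le (fun x => by positivity) (fun x => ?_)
    (lp_two_summable_sq hg)
  simpa using sq_le_sq.2 (h x)

theorem tsum_shift {d : ℕ} (f : (Fin d → ℤ) → ℝ) (z : Fin d → ℤ) :
    ∑' x, f (x + z) = ∑' x, f x :=
  (Equiv.addRight z).tsum_eq f

theorem summable_latticeEnergy {d : ℕ} {f : (Fin d → ℤ) → ℝ} (hf : Memℓp f 2) :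
    Summable fun x => ∑ i, latticeGrad f i x ^ 2 :=
  summable_sum fun i _ => lp_two_summable_sq (memℓp_grad hf i)

theorem latticeEnergy_eq_sum {d : ℕ} {f : (Fin d → ℤ) → ℝ} (hf : Memℓp f 2) :
    latticeEnergy f = ∑ i, ∑' x, latticeGrad f i x ^ 2 :=
  Summable.tsum_finsetSum fun i _ => lp_two_summable_sq (memℓp_grad hf i)

theorem latticeEnergy_nonneg {d : ℕ} (f : (Fin d → ℤ) → ℝ) : 0 ≤ latticeEnergy f :=
  tsum_nonneg fun _ => Finset.sum_nonneg fun _ _ => sq_nonneg _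

theorem tsum_sq_shift_nsmul_sub_le {d : ℕ} {f : (Fin d → ℤ) → ℝ} (hf : Memℓp f 2) (i : Fin d)
    (n : ℕ) :
    ∑' x, (f (x + n • latticeBasis i) - f x) ^ 2 ≤ (n : ℝ) ^ 2 * ∑' x, latticeGrad f i x ^ 2 := by
  have h1 : ∀ x, f (x + n • latticeBasis i) - f x
      = ∑ j ∈ Finset.range n, latticeGrad f i (x + j • latticeBasis i) := by
    intro x
    have := Finset.sum_range_sub (fun j : ℕ => f (x + j • latticeBasis i)) n
    simp only [zero_smul, add_zero] at this
    rw [← this]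
    refine Finset.sum_congr rfl fun j _ => ?_
    simp only [latticeGrad, add_smul, one_smul, add_assoc]
  have hs : ∀ j : ℕ, Summable fun x => latticeGrad f i (x + j • latticeBasis i) ^ 2 := fun j =>
    lp_two_summable_sq (memℓp_shift (memℓp_grad hf i) _)
  calc ∑' x, (f (x + n • latticeBasis i) - f x) ^ 2
      ≤ ∑' x, (n : ℝ) * ∑ j ∈ Finset.range n, latticeGrad f i (x + j • latticeBasis i) ^ 2 := by
        refine Summable.tsum_le_tsum (fun x => ?_)
          (lp_two_summable_sq ((memℓp_shift hf _).sub hf))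
          ((summable_sum fun j _ => hs j).mul_left _)
        rw [h1]
        simpa using sq_sum_le_card_mul_sum_sq (s := Finset.range n)
          (f := fun j => latticeGrad f i (x + j • latticeBasis i))
    _ = (n : ℝ) * ∑ j ∈ Finset.range n, ∑' x, latticeGrad f i (x + j • latticeBasis i) ^ 2 := by
        rw [tsum_mul_left, Summable.tsum_finsetSum fun j _ => hs j]
    _ = _ := by
        rw [Finset.sum_congr rfl fun j _ =>
          tsum_shift (fun x => latticeGrad f i x ^ 2) (j • latticeBasis i)]
        simp only [Finset.sum_const, Finset.card_range, nsmul_eq_mul]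
        ring

/-- The shift is performed one coordinate at a time; each use of $(a+b)^2\le 2a^2+2b^2$ costs a
factor 2, whence the power of 2. -/
theorem tsum_sq_shift_sub_le {d : ℕ} {f : (Fin d → ℤ) → ℝ} (hf : Memℓp f 2) {L : ℕ}
    {n : Fin d → ℕ} (hn : ∀ i, n i ≤ L) (s : Finset (Fin d)) :
    ∑' x, (f (x + ∑ i ∈ s, n i • latticeBasis i) - f x) ^ 2
      ≤ 2 ^ s.card * (L : ℝ) ^ 2 * ∑ i ∈ s, ∑' x, latticeGrad f i x ^ 2 := by
  classical
  induction s using Finset.induction_on with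
  | empty => simp
  | insert i s hi ih =>
    rw [Finset.sum_insert hi, Finset.sum_insert hi, Finset.card_insert_of_notMem hi]
    set z := ∑ i ∈ s, n i • latticeBasis i
    have hE : 0 ≤ ∑' x, latticeGrad f i x ^ 2 := tsum_nonneg fun _ => sq_nonneg _
    have h1 := tsum_sq_shift_nsmul_sub_le hf i (n i)
    have h2 : ((n i : ℕ) : ℝ) ^ 2 ≤ (L : ℝ) ^ 2 := by
      gcongr
      exact hn i
    have hg : Memℓp (fun x => f (x + n i • latticeBasis i) - f x) 2 := (memℓp_shift hf _).sub hf
    have s1 := (lp_two_summable_sq (memℓp_shift hg z)).mul_left 2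
    have s2 : Summable fun x => 2 * (f (x + z) - f x) ^ 2 :=
      (lp_two_summable_sq ((memℓp_shift hf z).sub hf)).mul_left 2
    have h3 : ∑' x, (f (x + (n i • latticeBasis i + z)) - f x) ^ 2
        ≤ 2 * ∑' x, (f (x + n i • latticeBasis i) - f x) ^ 2
          + 2 * ∑' x, (f (x + z) - f x) ^ 2 := by
      rw [← tsum_shift (fun x => (f (x + n i • latticeBasis i) - f x) ^ 2) z, ← tsum_mul_left,
        ← tsum_mul_left, ← Summable.tsum_add s1 s2]
      refine Summable.tsum_le_tsum (fun x => ?_)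
        (lp_two_summable_sq ((memℓp_shift hf _).sub hf)) (s1.add s2)
      have : x + (n i • latticeBasis i + z) = x + z + n i • latticeBasis i := by abel
      rw [this]
      nlinarith [sq_nonneg (f (x + z + n i • latticeBasis i) - f (x + z) - (f (x + z) - f x))]
    have h4 : (1 : ℝ) ≤ 2 ^ s.card := one_le_pow₀ (by norm_num)
    have h5 : (L : ℝ) ^ 2 * ∑' x, latticeGrad f i x ^ 2
        ≤ 2 ^ s.card * ((L : ℝ) ^ 2 * ∑' x, latticeGrad f i x ^ 2) :=
      le_mul_of_one_le_left (by positivity) h4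
    have h6 := mul_le_mul_of_nonneg_right h2 hE
    rw [pow_succ]
    linarith

/-- A scale-dependent form of Nash's inequality on `ℤ^d`. -/
theorem tsum_sq_le_nash {d : ℕ} {f : (Fin d → ℤ) → ℝ} (hf : Memℓp f 2)
    (hf1 : Summable fun x => |f x|) {L : ℕ} (hL : 1 ≤ L) :
    ∑' x, f x ^ 2 ≤ ((L : ℝ) ^ d)⁻¹ * (∑' x, |f x|) ^ 2 + 2 ^ d * (L : ℝ) ^ 2 * latticeEnergy f := by
  classical
  let B : Finset (Fin d → ℕ) := Fintype.piFinset fun _ => Finset.range L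
  let e : (Fin d → ℕ) → (Fin d → ℤ) := fun n i => (n i : ℤ)
  have he : Function.Injective e := fun n m h => by
    funext i
    exact Int.ofNat_injective (congrFun h i)
  have hsum : ∀ n : Fin d → ℕ, ∑ i, n i • (latticeBasis i : Fin d → ℤ) = e n := by
    intro n
    funext j
    simp [latticeBasis, e, Finset.sum_apply, Pi.single_apply]
  have hcard : (B.card : ℝ) = (L : ℝ) ^ d := by simp [B]
  have hLd : (0 : ℝ) < (L : ℝ) ^ d := by
    have : (0 : ℝ) < L := by exact_mod_cast hL
    positivity
  have s0 := lp_two_summable_sq hf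
  -- The left side is $\|f(\cdot+z)-f\|_2^2$ with $z=e(n)$, expanded. Summing over the $L^d$ shifts
  -- in the cube leaves only the cross terms to be controlled.
  have hD : ∀ n ∈ B, 2 * ∑' x, f x ^ 2 - 2 * ∑' x, f x * f (x + e n)
      ≤ 2 ^ d * (L : ℝ) ^ 2 * latticeEnergy f := by
    intro n hn
    have hn' : ∀ i, n i ≤ L := fun i => by
      have := Fintype.mem_piFinset.1 hn i
      exact (Finset.mem_range.1 this).le
    have h1 := tsum_sq_shift_sub_le hf hn' Finset.univ
    rw [hsum, ← latticeEnergy_eq_sum hf, Finset.card_univ, Fintype.card_fin] at h1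
    refine le_trans (le_of_eq ?_) h1
    have s1 := lp_two_summable_sq (memℓp_shift hf (e n))
    have s2 := (lp_two_summable_mul hf (memℓp_shift hf (e n))).mul_left 2
    have h2 : ∀ x, (f (x + e n) - f x) ^ 2 = (f (x + e n) ^ 2 + f x ^ 2) - 2 * (f x * f (x + e n)) :=
      fun x => by ring
    simp only [h2]
    rw [Summable.tsum_sub (s1.add s0) s2, Summable.tsum_add s1 s0, tsum_mul_left,
      tsum_shift (fun x => f x ^ 2)]
    ring
  -- For fixed $x$ the points $x+e(n)$ are distinct, so the sum over all shifts costs only one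
  -- factor $\|f\|_1$.
  have hcross : ∑ n ∈ B, ∑' x, f x * f (x + e n) ≤ (∑' x, |f x|) ^ 2 := by
    rw [← Summable.tsum_finsetSum fun n _ => lp_two_summable_mul hf (memℓp_shift hf (e n)),
      pow_two, ← tsum_mul_right]
    refine Summable.tsum_le_tsum (fun x => ?_)
      (summable_sum fun n _ => lp_two_summable_mul hf (memℓp_shift hf (e n))) (hf1.mul_right _)
    rw [← Finset.mul_sum]
    refine (le_abs_self _).trans ?_
    rw [abs_mul]
    refine mul_le_mul_of_nonneg_left ?_ (abs_nonneg _)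
    refine (Finset.abs_sum_le_sum_abs _ _).trans ?_
    have hinj : Function.Injective fun n => x + e n := fun n m h => he (add_left_cancel h)
    have hmap := Finset.sum_map B ⟨fun n => x + e n, hinj⟩ (fun z => |f z|)
    simp only [Function.Embedding.coeFn_mk] at hmap
    rw [← hmap]
    exact hf1.sum_le_tsum _ fun _ _ => abs_nonneg _
  have h := Finset.sum_le_sum hD
  rw [Finset.sum_sub_distrib, Finset.sum_const, Finset.sum_const, nsmul_eq_mul, nsmul_eq_mul,
    ← Finset.mul_sum, hcard] at h
  have hE := latticeEnergy_nonneg f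
  have h7 : (L : ℝ) ^ d * ∑' x, f x ^ 2
      ≤ (∑' x, |f x|) ^ 2 + (L : ℝ) ^ d * (2 ^ d * (L : ℝ) ^ 2 * latticeEnergy f) := by
    have : 0 ≤ (L : ℝ) ^ d * (2 ^ d * (L : ℝ) ^ 2 * latticeEnergy f) := by positivity
    nlinarith
  calc ∑' x, f x ^ 2 = ((L : ℝ) ^ d)⁻¹ * ((L : ℝ) ^ d * ∑' x, f x ^ 2) := by field_simp
    _ ≤ ((L : ℝ) ^ d)⁻¹ * ((∑' x, |f x|) ^ 2
          + (L : ℝ) ^ d * (2 ^ d * (L : ℝ) ^ 2 * latticeEnergy f)) := by gcongr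
    _ = _ := by field_simp

theorem IsConductivity.le_basis {d : ℕ} {α β : ℝ} {a : (Fin d → ℤ) → (Fin d → ℤ) → ℝ}
    (ha : IsConductivity α β a) (x : Fin d → ℤ) (i : Fin d) : α ≤ a x (x + latticeBasis i) :=
  (ha.mem_Icc _ _ (latticeNorm_basis x i)).1

theorem IsConductivity.basis_le {d : ℕ} {α β : ℝ} {a : (Fin d → ℤ) → (Fin d → ℤ) → ℝ}
    (ha : IsConductivity α β a) (x : Fin d → ℤ) (i : Fin d) : a x (x + latticeBasis i) ≤ β :=
  (ha.mem_Icc _ _ (latticeNorm_basis x i)).2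

theorem summable_grad_mul {d : ℕ} {α β : ℝ} (hα : 0 < α)
    {a : (Fin d → ℤ) → (Fin d → ℤ) → ℝ} (ha : IsConductivity α β a) {u v : (Fin d → ℤ) → ℝ}
    (hu : Memℓp u 2) (hv : Memℓp v 2) : Summable fun x =>
      ∑ i, latticeGrad v i x * (a x (x + latticeBasis i) * latticeGrad u i x) := by
  refine summable_sum fun i _ => lp_two_summable_mul (memℓp_grad hv i)
    (memℓp_bdd_mul (β := β) (fun x => ?_) (memℓp_grad hu i))
  rw [abs_of_nonneg (hα.le.trans (ha.le_basis x i))]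
  exact ha.basis_le x i

/-! ### Truncations of the Green's function: positivity, slice energy, total mass. -/

section Truncation

variable {d : ℕ} {α β T : ℝ} {a : (Fin d → ℤ) → (Fin d → ℤ) → ℝ} {y : Fin d → ℤ}
  {u : (Fin d → ℤ) → ℝ}

theorem abs_comp_le {φ : ℝ → ℝ} (hφ : LipschitzWith 1 φ) (h0 : φ 0 = 0) (s : ℝ) :
    |φ s| ≤ |s| := by
  simpa [h0, Real.dist_eq] using hφ.dist_le_mul s 0

/-- Applied on each edge, this lets the form tested with $\varphi(u)$ dominate the energy of
$\varphi(u)$. -/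
theorem sq_comp_sub_le {φ : ℝ → ℝ} (hm : Monotone φ) (hφ : LipschitzWith 1 φ) (s t : ℝ) :
    (φ s - φ t) ^ 2 ≤ (φ s - φ t) * (s - t) := by
  have h1 : |φ s - φ t| ≤ |s - t| := by simpa [Real.dist_eq] using hφ.dist_le_mul s t
  rcases le_total s t with h | h
  · have := hm h
    rw [abs_of_nonpos (by linarith), abs_of_nonpos (by linarith)] at h1
    nlinarith
  · have := hm h
    rw [abs_of_nonneg (by linarith), abs_of_nonneg (by linarith)] at h1
    nlinarith

/-- Testing the equation with a monotone `1`-Lipschitz function of the solution. -/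
theorem IsGreenFunction.energy_comp_le (hu : IsGreenFunction T a y u) (hα : 0 < α)
    (ha : IsConductivity α β a) {φ : ℝ → ℝ} (hm : Monotone φ) (hφ : LipschitzWith 1 φ)
    (h0 : φ 0 = 0) :
    T⁻¹ * ∑' x, u x * φ (u x) + α * latticeEnergy (fun x => φ (u x)) ≤ φ (u y) := by
  have hv : Memℓp (fun x => φ (u x)) 2 :=
    memℓp_two_of_abs_le hu.memℓp fun x => abs_comp_le hφ h0 _
  rw [← hu.weak_eq _ hv, ← tsum_mul_left, latticeEnergy, ← tsum_mul_left]
  refine add_le_add (le_of_eq (tsum_congr fun x => by ring)) ?_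
  refine Summable.tsum_le_tsum (fun x => ?_) ((summable_latticeEnergy hv).mul_left α)
    (summable_grad_mul hα ha hu.memℓp hv)
  rw [Finset.mul_sum]
  refine Finset.sum_le_sum fun i _ => ?_
  have h1 : latticeGrad (fun x => φ (u x)) i x ^ 2
      ≤ latticeGrad (fun x => φ (u x)) i x * latticeGrad u i x := sq_comp_sub_le hm hφ _ _
  have h2 := ha.le_basis x i
  calc α * latticeGrad (fun x => φ (u x)) i x ^ 2
      ≤ a x (x + latticeBasis i) * (latticeGrad (fun x => φ (u x)) i x * latticeGrad u i x) :=
        mul_le_mul h2 h1 (sq_nonneg _) (hα.le.trans h2)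
    _ = _ := by ring

/-- The negative part $\min(u,0)$ is tested: the right-hand side $\min(u(y),0)$ is at most 0, while
$u\min(u,0)=\min(u,0)^2$. -/
theorem IsGreenFunction.nonneg (hu : IsGreenFunction T a y u) (hα : 0 < α) (hT : 0 < T)
    (ha : IsConductivity α β a) (x : Fin d → ℤ) : 0 ≤ u x := by
  have hφ : LipschitzWith 1 fun s : ℝ => min s 0 := LipschitzWith.id.min_const 0
  have h := hu.energy_comp_le hα ha (φ := fun s => min s 0)
    (fun s t h => min_le_min_right _ h) hφ (by simp)
  have hE := latticeEnergy_nonneg fun x => min (u x) 0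
  have h1 : ∑' x, u x * min (u x) 0 ≤ 0 := by
    have h2 : T⁻¹ * ∑' x, u x * min (u x) 0 ≤ 0 := by
      have := min_le_right (u y) 0
      have := mul_nonneg hα.le hE
      linarith
    by_contra h3
    push Not at h3
    have : 0 < T⁻¹ * ∑' x, u x * min (u x) 0 := by positivity
    linarith
  by_contra hx
  push Not at hx
  have hs : Summable fun x => u x * min (u x) 0 := lp_two_summable_mul hu.memℓp
    (memℓp_two_of_abs_le hu.memℓp fun x => abs_comp_le hφ (by simp) _)
  have hnn : ∀ x, 0 ≤ u x * min (u x) 0 := fun x => by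
    rcases le_total (u x) 0 with h | h
    · rw [min_eq_left h]; exact mul_self_nonneg _
    · rw [min_eq_right h]; simp
  have h4 := hs.le_tsum x fun z _ => hnn z
  rw [min_eq_left hx.le] at h4
  nlinarith

theorem lipschitzWith_clamp (lo k : ℝ) : LipschitzWith 1 fun s : ℝ => min (max (s - lo) 0) k :=
  ((LipschitzWith.id.sub (LipschitzWith.const lo)).weaken (by simp)).max_const 0 |>.min_const k

theorem monotone_clamp (lo k : ℝ) : Monotone fun s : ℝ => min (max (s - lo) 0) k :=
  fun s t h => min_le_min_right _ (max_le_max_right _ (by linarith))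

/-- The truncation is at most $k$ at the pole, and the zeroth-order term has a good sign and can be
dropped. Hence the bound is independent of $T$ and of the height of the slice. -/
theorem IsGreenFunction.energy_clamp_le (hu : IsGreenFunction T a y u) (hα : 0 < α) (hT : 0 < T)
    (ha : IsConductivity α β a) {lo k : ℝ} (hlo : 0 ≤ lo) (hk : 0 ≤ k) :
    latticeEnergy (fun x => min (max (u x - lo) 0) k) ≤ α⁻¹ * k := by
  have h := hu.energy_comp_le hα ha (monotone_clamp lo k) (lipschitzWith_clamp lo k)
    (by simp [hlo, hk])
  have h1 : 0 ≤ T⁻¹ * ∑' x, u x * min (max (u x - lo) 0) k :=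
    mul_nonneg (by positivity) (tsum_nonneg fun x => mul_nonneg (hu.nonneg hα hT ha x)
      (le_min (le_max_right _ _) hk))
  have h2 : min (max (u y - lo) 0) k ≤ k := min_le_right _ _
  rw [inv_mul_eq_div, le_div_iff₀' hα]
  linarith

/-- The constant 1 would give the mass directly but is not in $\ell^2$. Its substitute is
$\min(u,k)/k$, with $k$ the least positive value of $u$ on $F$, which equals 1 wherever $u>0$ on
$F$. -/
theorem IsGreenFunction.sum_le (hu : IsGreenFunction T a y u) (hα : 0 < α) (hT : 0 < T)
    (ha : IsConductivity α β a) (F : Finset (Fin d → ℤ)) : ∑ x ∈ F, u x ≤ T := by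
  classical
  have hnn := hu.nonneg hα hT ha
  rcases (F.filter fun x => 0 < u x).eq_empty_or_nonempty with hF | hF
  · refine le_trans (Finset.sum_nonpos fun x hx => ?_) hT.le
    by_contra h
    have : x ∈ F.filter fun x => 0 < u x := Finset.mem_filter.2 ⟨hx, not_le.1 h⟩
    simp [hF] at this
  · obtain ⟨z, hz, hmin⟩ := Finset.exists_min_image _ u hF
    have hz0 := (Finset.mem_filter.1 hz).2
    set k := u z
    have h := hu.energy_comp_le hα ha (monotone_clamp 0 k) (lipschitzWith_clamp 0 k)
      (by simp [hz0.le])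
    have hE := mul_nonneg hα.le (latticeEnergy_nonneg fun x => min (max (u x - 0) 0) k)
    have hs : Summable fun x => u x * min (max (u x - 0) 0) k := lp_two_summable_mul hu.memℓp
      (memℓp_two_of_abs_le hu.memℓp fun x => abs_comp_le (lipschitzWith_clamp 0 k)
        (by simp [hz0.le]) _)
    have h1 : ∑ x ∈ F, u x * k ≤ ∑' x, u x * min (max (u x - 0) 0) k := by
      refine le_trans (Finset.sum_le_sum fun x hx => ?_) (hs.sum_le_tsum F fun x _ =>
        mul_nonneg (hnn x) (le_min (le_max_right _ _) hz0.le))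
      rcases (hnn x).eq_or_lt with h | h
      · rw [← h]; simp
      · have : k ≤ u x := hmin x (Finset.mem_filter.2 ⟨hx, h⟩)
        rw [sub_zero, max_eq_left h.le, min_eq_right this]
    rw [← Finset.sum_mul] at h1
    have h2 : min (max (u y - 0) 0) k ≤ k := min_le_right _ _
    have h3 : T⁻¹ * ((∑ x ∈ F, u x) * k) ≤ k := by
      refine le_trans (mul_le_mul_of_nonneg_left h1 (by positivity)) ?_
      linarith
    have h4 : T⁻¹ * (∑ x ∈ F, u x) ≤ 1 := by
      by_contra h5
      push Not at h5
      nlinarith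
    rwa [inv_mul_eq_div, div_le_one hT] at h4

end Truncation

/-! ### Subsolutions away from the pole and Caccioppoli's inequality. -/

section Subsolution

variable {d : ℕ} {α β T : ℝ} {a : (Fin d → ℤ) → (Fin d → ℤ) → ℝ} {y : Fin d → ℤ}
  {w : (Fin d → ℤ) → ℝ}

/-- `w` is a weak subsolution of `T⁻¹ w - ∇*·A∇w = 0` away from `y`. -/
def IsSubsolution (T : ℝ) (a : (Fin d → ℤ) → (Fin d → ℤ) → ℝ) (y : Fin d → ℤ)
    (w : (Fin d → ℤ) → ℝ) : Prop :=
  ∀ v : (Fin d → ℤ) → ℝ, (Function.support v).Finite → (∀ x, 0 ≤ v x) → v y = 0 →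
    ∑' x, T⁻¹ * w x * v x
      + ∑' x, ∑ i, latticeGrad v i x * (a x (x + latticeBasis i) * latticeGrad w i x) ≤ 0

theorem IsGreenFunction.isSubsolution {u : (Fin d → ℤ) → ℝ} (hu : IsGreenFunction T a y u) :
    IsSubsolution T a y u := fun v hv _ hy =>
  (hu.weak_eq v (memℓp_two_of_finite_support hv)).trans_le hy.le

theorem summable_mul_of_finite_support {ι : Type*} {v : ι → ℝ} (hv : (Function.support v).Finite)
    (f : ι → ℝ) : Summable fun x => f x * v x :=
  summable_of_hasFiniteSupport (hv.subset fun x hx h => hx (by simp [h]))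

theorem latticeGrad_support_finite {v : (Fin d → ℤ) → ℝ} (hv : (Function.support v).Finite)
    (i : Fin d) : (Function.support (latticeGrad v i)).Finite := by
  refine (hv.union (hv.preimage (f := fun x => x + latticeBasis i)
    (add_left_injective _).injOn)).subset fun x hx => ?_
  by_contra h
  simp only [Set.mem_union, Set.mem_preimage, Function.mem_support, not_or, not_not] at h
  exact hx (by simp [latticeGrad, h.1, h.2])

theorem summable_grad_mul_of_finite_support {v : (Fin d → ℤ) → ℝ}
    (hv : (Function.support v).Finite) (g : Fin d → (Fin d → ℤ) → ℝ) :
    Summable fun x => ∑ i, latticeGrad v i x * g i x :=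
  summable_sum fun i _ => by
    simpa only [mul_comm] using summable_mul_of_finite_support (latticeGrad_support_finite hv i) (g i)

/-- The equation for $w$ is tested with $2wv$. On the edge $(x,x+e_i)$ one has
$\nabla_i(2wv)\nabla_i w-\nabla_i v\nabla_i(w^2)=(v(x)+v(x+e_i))(\nabla_i w)^2\ge0$, and the
zeroth-order term is doubled. -/
theorem IsSubsolution.sq (hw : IsSubsolution T a y w) (hw0 : ∀ x, 0 ≤ w x) (hT : 0 < T)
    (hα : 0 < α) (ha : IsConductivity α β a) : IsSubsolution T a y fun x => w x ^ 2 := by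
  intro v hv hv0 hy
  have hv2 : (Function.support fun x => 2 * w x * v x).Finite :=
    hv.subset fun x hx h => hx (by simp [h])
  refine le_trans (add_le_add ?_ ?_) (hw (fun x => 2 * w x * v x) hv2
    (fun x => mul_nonneg (mul_nonneg zero_le_two (hw0 x)) (hv0 x)) (by simp [hy]))
  · refine Summable.tsum_le_tsum (fun x => ?_) (summable_mul_of_finite_support hv _)
      (summable_mul_of_finite_support hv2 _)
    have : 0 ≤ T⁻¹ * w x ^ 2 * v x := mul_nonneg (by positivity) (hv0 x)
    linarith
  · refine Summable.tsum_le_tsum (fun x => Finset.sum_le_sum fun i _ => ?_)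
      (summable_grad_mul_of_finite_support hv _) (summable_grad_mul_of_finite_support hv2 _)
    have h1 : 0 ≤ a x (x + latticeBasis i) := hα.le.trans (ha.le_basis x i)
    have h2 : latticeGrad v i x * latticeGrad (fun x => w x ^ 2) i x
        ≤ latticeGrad (fun x => 2 * w x * v x) i x * latticeGrad w i x := by
      simp only [latticeGrad]
      have h3 := mul_nonneg (hv0 x) (sq_nonneg (w (x + latticeBasis i) - w x))
      have h4 := mul_nonneg (hv0 (x + latticeBasis i)) (sq_nonneg (w (x + latticeBasis i) - w x))
      nlinarith
    have := mul_le_mul_of_nonneg_left h2 h1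
    linarith

theorem IsSubsolution.pow_two_pow (hw : IsSubsolution T a y w) (hw0 : ∀ x, 0 ≤ w x) (hT : 0 < T)
    (hα : 0 < α) (ha : IsConductivity α β a) (m : ℕ) :
    IsSubsolution T a y fun x => w x ^ 2 ^ m := by
  induction m with
  | zero => simpa using hw
  | succ m ih =>
    have := ih.sq (fun x => pow_nonneg (hw0 x) _) hT hα ha
    simpa only [← pow_mul, ← pow_succ] using this

/-- The Caccioppoli inequality. -/
theorem IsSubsolution.caccioppoli (hw : IsSubsolution T a y w) (hw0 : ∀ x, 0 ≤ w x)
    (ha : IsConductivity α β a) {η : (Fin d → ℤ) → ℝ}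
    (hη : (Function.support η).Finite) (hy : η y = 0) :
    T⁻¹ * ∑' x, (η x * w x) ^ 2 + α * latticeEnergy (fun x => η x * w x)
      ≤ β * ∑' x, ∑ i, w x * w (x + latticeBasis i) * latticeGrad η i x ^ 2 := by
  have hv : (Function.support fun x => η x ^ 2 * w x).Finite :=
    hη.subset fun x hx h => hx (by simp [h])
  have hηw : (Function.support fun x => η x * w x).Finite :=
    hη.subset fun x hx h => hx (by simp [h])
  have h := hw (fun x => η x ^ 2 * w x) hv (fun x => mul_nonneg (sq_nonneg _) (hw0 x))
    (by simp [hy])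
  have h1 : ∑' x, T⁻¹ * w x * (η x ^ 2 * w x) = T⁻¹ * ∑' x, (η x * w x) ^ 2 := by
    rw [← tsum_mul_left]
    exact tsum_congr fun x => by ring
  have s1 : Summable fun x => ∑ i, latticeGrad (fun x => η x * w x) i x ^ 2 := by
    simpa only [pow_two] using summable_grad_mul_of_finite_support hηw _
  have s2 : Summable fun x => ∑ i, w x * w (x + latticeBasis i) * latticeGrad η i x ^ 2 := by
    have := summable_grad_mul_of_finite_support hη
      fun i x => w x * w (x + latticeBasis i) * latticeGrad η i x
    refine this.congr fun x => Finset.sum_congr rfl fun i _ => by ring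
  have h2 : α * latticeEnergy (fun x => η x * w x)
      - β * ∑' x, ∑ i, w x * w (x + latticeBasis i) * latticeGrad η i x ^ 2
      ≤ ∑' x, ∑ i, latticeGrad (fun x => η x ^ 2 * w x) i x
          * (a x (x + latticeBasis i) * latticeGrad w i x) := by
    rw [latticeEnergy, ← tsum_mul_left, ← tsum_mul_left,
      ← Summable.tsum_sub (s1.mul_left α) (s2.mul_left β)]
    refine Summable.tsum_le_tsum (fun x => ?_) ((s1.mul_left α).sub (s2.mul_left β))
      (summable_grad_mul_of_finite_support hv _)
    rw [Finset.mul_sum, Finset.mul_sum, ← Finset.sum_sub_distrib]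
    refine Finset.sum_le_sum fun i _ => ?_
    -- This exact discrete product rule leaves no mixed term to absorb; the price is the product of
    -- $w$ at the two endpoints in place of $w^2$.
    have e1 : latticeGrad (fun x => η x ^ 2 * w x) i x * latticeGrad w i x
        = latticeGrad (fun x => η x * w x) i x ^ 2
          - w x * w (x + latticeBasis i) * latticeGrad η i x ^ 2 := by
      simp only [latticeGrad]
      ring
    have h3 : 0 ≤ w x * w (x + latticeBasis i) * latticeGrad η i x ^ 2 :=
      mul_nonneg (mul_nonneg (hw0 _) (hw0 _)) (sq_nonneg _)
    have h4 := mul_le_mul_of_nonneg_right (ha.le_basis x i)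
      (sq_nonneg (latticeGrad (fun x => η x * w x) i x))
    have h5 := mul_le_mul_of_nonneg_right (ha.basis_le x i) h3
    calc _ ≤ a x (x + latticeBasis i) * (latticeGrad (fun x => η x * w x) i x ^ 2
          - w x * w (x + latticeBasis i) * latticeGrad η i x ^ 2) := by linarith
      _ = _ := by rw [← e1]; ring
  linarith

end Subsolution

/-! ### Localization between superlevel sets of a cutoff profile. -/

section Superlevel

variable {d : ℕ} {α β T : ℝ} {a : (Fin d → ℤ) → (Fin d → ℤ) → ℝ} {y : Fin d → ℤ}
  {w ψ : (Fin d → ℤ) → ℝ} {S : Finset (Fin d → ℤ)}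

/-- A function varying by at most `1` along edges, negative at `y`, whose nonnegativity set is
contained in the finite set `S`. -/
structure IsCutoffProfile (S : Finset (Fin d → ℤ)) (y : Fin d → ℤ) (ψ : (Fin d → ℤ) → ℝ) :
    Prop where
  abs_grad_le : ∀ x i, |latticeGrad ψ i x| ≤ 1
  mem_of_nonneg : ∀ x, 0 ≤ ψ x → x ∈ S
  neg : ψ y < 0

/-- The points of `S` where `ψ` is at least `t`. -/
noncomputable def superlevel (S : Finset (Fin d → ℤ)) (ψ : (Fin d → ℤ) → ℝ) (t : ℝ) :
    Finset (Fin d → ℤ) :=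
  S.filter fun x => t ≤ ψ x

theorem superlevel_anti {s t : ℝ} (h : s ≤ t) : superlevel S ψ t ⊆ superlevel S ψ s :=
  Finset.monotone_filter_right _ fun _ _ hx => h.trans hx

theorem sum_superlevel_anti {s t : ℝ} (h : s ≤ t) {f : (Fin d → ℤ) → ℝ} (hf : ∀ x, 0 ≤ f x) :
    ∑ x ∈ superlevel S ψ t, f x ≤ ∑ x ∈ superlevel S ψ s, f x :=
  Finset.sum_le_sum_of_subset_of_nonneg (superlevel_anti h) fun _ _ _ => hf _

theorem IsCutoffProfile.mem_superlevel (hψ : IsCutoffProfile S y ψ) {t : ℝ} (ht : 0 ≤ t)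
    {x : Fin d → ℤ} : x ∈ superlevel S ψ t ↔ t ≤ ψ x := by
  simp only [superlevel, Finset.mem_filter, and_iff_right_iff_imp]
  exact fun h => hψ.mem_of_nonneg _ (ht.trans h)

/-- The Caccioppoli inequality between two superlevel sets of `ψ`. -/
theorem IsSubsolution.exists_localization (hw : IsSubsolution T a y w) (hw0 : ∀ x, 0 ≤ w x)
    (hα : 0 < α) (hαβ : α ≤ β) (hT : 0 < T) (ha : IsConductivity α β a)
    (hψ : IsCutoffProfile S y ψ) {s t : ℝ} (ht : 0 ≤ t) (hs : 2 ≤ s) :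
    T⁻¹ * ∑ x ∈ superlevel S ψ (t + s), w x ^ 2
        ≤ 4 * d * β / s ^ 2 * ∑ x ∈ superlevel S ψ t, w x ^ 2 ∧
      ∃ f : (Fin d → ℤ) → ℝ, (∀ x ∉ superlevel S ψ t, f x = 0) ∧ (∀ x, |f x| ≤ w x) ∧
        (∀ x ∈ superlevel S ψ (t + s), f x = w x) ∧
        α * latticeEnergy f ≤ 4 * d * β / s ^ 2 * ∑ x ∈ superlevel S ψ t, w x ^ 2 := by
  classical
  have hβ : 0 < β := hα.trans_le hαβ
  have hs1 : 0 < s - 1 := by linarith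
  -- The ramp starts at $t+1$ rather than $t$: as $\psi$ varies by at most 1 along an edge, every
  -- edge with $\nabla\eta\ne0$ then has both endpoints in $\{\psi\ge t\}$. The slope $1/(s-1)$ is
  -- at most $2/s$ because $s\ge2$.
  let η : (Fin d → ℤ) → ℝ := fun x => max 0 (min 1 ((ψ x - t - 1) / (s - 1)))
  have hη0 : ∀ x, ψ x ≤ t + 1 → η x = 0 := fun x hx => by
    refine max_eq_left (min_le_of_right_le (div_nonpos_of_nonpos_of_nonneg ?_ hs1.le))
    linarith
  have hη1 : ∀ x ∈ superlevel S ψ (t + s), η x = 1 := fun x hx => by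
    have h1 : t + s ≤ ψ x := (Finset.mem_filter.1 hx).2
    have h2 : 1 ≤ (ψ x - t - 1) / (s - 1) := by
      rw [le_div_iff₀ hs1]
      linarith
    simp [η, min_eq_left h2]
  have hηnn : ∀ x, 0 ≤ η x := fun x => le_max_left _ _
  have hηle : ∀ x, η x ≤ 1 := fun x => max_le zero_le_one (min_le_left _ _)
  have hηout : ∀ x ∉ superlevel S ψ t, η x = 0 := fun x hx => by
    rw [hψ.mem_superlevel ht, not_le] at hx
    exact hη0 x (by linarith)
  have hηfin : (Function.support η).Finite :=
    (superlevel S ψ t).finite_toSet.subset fun x hx => by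
      by_contra h
      exact hx (hηout x h)
  have hηy : η y = 0 := hη0 y (by linarith [hψ.neg])
  have hηgrad : ∀ x i, latticeGrad η i x ^ 2 ≤ 4 / s ^ 2 := by
    intro x i
    have h1 : |latticeGrad η i x| ≤ 2 / s := by
      calc |latticeGrad η i x|
          ≤ |(ψ (x + latticeBasis i) - t - 1) / (s - 1) - (ψ x - t - 1) / (s - 1)| := by
            refine (abs_max_sub_max_le_max _ _ _ _).trans ?_
            rw [sub_self, abs_zero, max_eq_right (abs_nonneg _)]
            refine (abs_min_sub_min_le_max _ _ _ _).trans ?_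
            rw [sub_self, abs_zero, max_eq_right (abs_nonneg _)]
        _ = |latticeGrad ψ i x| / (s - 1) := by
            rw [← sub_div, abs_div, abs_of_pos hs1, latticeGrad]
            congr 2
            ring
        _ ≤ 1 / (s - 1) := by
            gcongr
            exact hψ.abs_grad_le x i
        _ ≤ 2 / s := by
            rw [div_le_div_iff₀ hs1 (by linarith)]
            linarith
    calc latticeGrad η i x ^ 2 = |latticeGrad η i x| ^ 2 := (sq_abs _).symm
      _ ≤ (2 / s) ^ 2 := by gcongr
      _ = 4 / s ^ 2 := by ring
  let g : (Fin d → ℤ) → ℝ := fun x => if x ∈ superlevel S ψ t then w x ^ 2 else 0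
  have hg0 : ∀ x, 0 ≤ g x := fun x => by
    simp only [g]
    split_ifs
    · exact sq_nonneg _
    · exact le_rfl
  have hgs : Summable g := summable_of_ne_finset_zero (s := superlevel S ψ t) fun x hx => if_neg hx
  have hgsum : ∑' x, g x = ∑ x ∈ superlevel S ψ t, w x ^ 2 := by
    rw [tsum_eq_sum (s := superlevel S ψ t) fun x hx => if_neg hx]
    exact Finset.sum_congr rfl fun x hx => if_pos hx
  have hterm : ∀ x i, w x * w (x + latticeBasis i) * latticeGrad η i x ^ 2
      ≤ 2 / s ^ 2 * (g x + g (x + latticeBasis i)) := by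
    intro x i
    have hR : 0 ≤ 2 / s ^ 2 * (g x + g (x + latticeBasis i)) :=
      mul_nonneg (by positivity) (add_nonneg (hg0 _) (hg0 _))
    have hgr := abs_le.1 (hψ.abs_grad_le x i)
    simp only [latticeGrad] at hgr
    by_cases h1 : t ≤ ψ x
    · by_cases h2 : t ≤ ψ (x + latticeBasis i)
      · have e1 : g x = w x ^ 2 := if_pos ((hψ.mem_superlevel ht).2 h1)
        have e2 : g (x + latticeBasis i) = w (x + latticeBasis i) ^ 2 :=
          if_pos ((hψ.mem_superlevel ht).2 h2)
        rw [e1, e2]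
        calc w x * w (x + latticeBasis i) * latticeGrad η i x ^ 2
            ≤ w x * w (x + latticeBasis i) * (4 / s ^ 2) :=
              mul_le_mul_of_nonneg_left (hηgrad x i) (mul_nonneg (hw0 _) (hw0 _))
          _ = 2 / s ^ 2 * (2 * w x * w (x + latticeBasis i)) := by ring
          _ ≤ _ := mul_le_mul_of_nonneg_left (two_mul_le_add_sq _ _) (by positivity)
      · have : latticeGrad η i x = 0 := by
          rw [latticeGrad, hη0 _ (by linarith), hη0 _ (by linarith), sub_zero]
        rw [this]
        simpa using hR
    · have : latticeGrad η i x = 0 := by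
        rw [latticeGrad, hη0 _ (by linarith), hη0 _ (by linarith), sub_zero]
      rw [this]
      simpa using hR
  have hgs' : ∀ i : Fin d, Summable fun x => g (x + latticeBasis i) := fun i =>
    hgs.comp_injective (add_left_injective (latticeBasis i))
  have hsR : Summable fun x => ∑ i, 2 / s ^ 2 * (g x + g (x + latticeBasis i)) :=
    summable_sum fun i _ => (hgs.add (hgs' i)).mul_left _
  have hsL : Summable fun x => ∑ i, w x * w (x + latticeBasis i) * latticeGrad η i x ^ 2 :=
    Summable.of_nonneg_of_le (fun x => Finset.sum_nonneg fun i _ =>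
      mul_nonneg (mul_nonneg (hw0 _) (hw0 _)) (sq_nonneg _))
      (fun x => Finset.sum_le_sum fun i _ => hterm x i) hsR
  have hRHS : β * ∑' x, ∑ i, w x * w (x + latticeBasis i) * latticeGrad η i x ^ 2
      ≤ 4 * d * β / s ^ 2 * ∑ x ∈ superlevel S ψ t, w x ^ 2 := by
    calc β * ∑' x, ∑ i, w x * w (x + latticeBasis i) * latticeGrad η i x ^ 2
        ≤ β * ∑' x, ∑ i, 2 / s ^ 2 * (g x + g (x + latticeBasis i)) := by
          refine mul_le_mul_of_nonneg_left ?_ hβ.le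
          exact Summable.tsum_le_tsum (fun x => Finset.sum_le_sum fun i _ => hterm x i) hsL hsR
      _ = _ := by
          rw [Summable.tsum_finsetSum fun i _ => (hgs.add (hgs' i)).mul_left _]
          simp only [tsum_mul_left]
          rw [Finset.sum_congr rfl fun i _ => by
            rw [Summable.tsum_add hgs (hgs' i), tsum_shift g, hgsum]]
          simp only [Finset.sum_const, Finset.card_univ, Fintype.card_fin, nsmul_eq_mul]
          ring
  have hcacc := (hw.caccioppoli hw0 ha hηfin hηy).trans hRHS
  have hηwfin : (Function.support fun x => (η x * w x) ^ 2).Finite :=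
    hηfin.subset fun x hx h => hx (by simp [h])
  have hmass : ∑ x ∈ superlevel S ψ (t + s), w x ^ 2 ≤ ∑' x, (η x * w x) ^ 2 := by
    refine le_trans (le_of_eq ?_) ((summable_of_hasFiniteSupport hηwfin).sum_le_tsum
      (superlevel S ψ (t + s)) fun x _ => sq_nonneg _)
    exact Finset.sum_congr rfl fun x hx => by rw [hη1 x hx, one_mul]
  have hTi : 0 < T⁻¹ := inv_pos.2 hT
  refine ⟨?_, fun x => η x * w x, fun x hx => ?_, fun x => ?_, fun x hx => ?_, ?_⟩
  · have h1 := mul_le_mul_of_nonneg_left hmass hTi.le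
    have h2 := mul_nonneg hα.le (latticeEnergy_nonneg fun x => η x * w x)
    linarith
  · simp [hηout x hx]
  · rw [abs_mul, abs_of_nonneg (hηnn x), abs_of_nonneg (hw0 x)]
    exact mul_le_of_le_one_left (hw0 x) (hηle x)
  · simp [hη1 x hx]
  · have h2 : 0 ≤ T⁻¹ * ∑' x, (η x * w x) ^ 2 :=
      mul_nonneg hTi.le (tsum_nonneg fun _ => sq_nonneg _)
    linarith

/-- Nash's inequality for the localized function, with its energy bounded by Caccioppoli. The scale
$L$ stays free, so that the $\ell^2$ term can be made small by taking $L/s$ small. -/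
theorem IsSubsolution.sum_sq_le_nash (hw : IsSubsolution T a y w) (hw0 : ∀ x, 0 ≤ w x)
    (hα : 0 < α) (hαβ : α ≤ β) (hT : 0 < T) (ha : IsConductivity α β a)
    (hψ : IsCutoffProfile S y ψ) {s t : ℝ} (ht : 0 ≤ t) (hs : 2 ≤ s) {L : ℕ} (hL : 1 ≤ L) :
    ∑ x ∈ superlevel S ψ (t + s), w x ^ 2
      ≤ ((L : ℝ) ^ d)⁻¹ * (∑ x ∈ superlevel S ψ t, w x) ^ 2
        + 2 ^ d * (4 * d * β / α) * (L / s) ^ 2 * ∑ x ∈ superlevel S ψ t, w x ^ 2 := by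
  obtain ⟨-, f, hf0, hfle, hfeq, hfE⟩ := hw.exists_localization hw0 hα hαβ hT ha hψ ht hs
  have hfin : (Function.support f).Finite :=
    (superlevel S ψ t).finite_toSet.subset fun x hx => by
      by_contra h
      exact hx (hf0 x h)
  have hf2 := memℓp_two_of_finite_support hfin
  have hf1 : Summable fun x => |f x| := summable_of_hasFiniteSupport
    (hfin.subset fun x hx h => hx (by simp [h]))
  have hnash := tsum_sq_le_nash hf2 hf1 hL
  have h1 : ∑ x ∈ superlevel S ψ (t + s), w x ^ 2 ≤ ∑' x, f x ^ 2 := by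
    refine le_trans (le_of_eq ?_) ((lp_two_summable_sq hf2).sum_le_tsum
      (superlevel S ψ (t + s)) fun x _ => sq_nonneg _)
    exact Finset.sum_congr rfl fun x hx => by rw [hfeq x hx]
  have h2 : ∑' x, |f x| ≤ ∑ x ∈ superlevel S ψ t, w x := by
    rw [tsum_eq_sum (s := superlevel S ψ t) fun x hx => by rw [hf0 x hx, abs_zero]]
    exact Finset.sum_le_sum fun x _ => hfle x
  have h3 : 0 ≤ ∑' x, |f x| := tsum_nonneg fun _ => abs_nonneg _
  have h4 : latticeEnergy f
      ≤ α⁻¹ * (4 * d * β / s ^ 2 * ∑ x ∈ superlevel S ψ t, w x ^ 2) := by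
    rw [inv_mul_eq_div, le_div_iff₀' hα]
    exact hfE
  calc _ ≤ _ := h1.trans hnash
    _ ≤ ((L : ℝ) ^ d)⁻¹ * (∑ x ∈ superlevel S ψ t, w x) ^ 2 + 2 ^ d * (L : ℝ) ^ 2 *
        (α⁻¹ * (4 * d * β / s ^ 2 * ∑ x ∈ superlevel S ψ t, w x ^ 2)) := by gcongr
    _ = _ := by
        congr 1
        ring

end Superlevel

/-! ### Reverse Hölder inequalities and Moser iteration. -/

section ReverseHolder

/-- Reverse Hölder inequality for nonnegative subsolutions: `L¹` controls `L²` on smaller sets. -/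
theorem exists_sum_sq_le_sum (d : ℕ) {α β : ℝ} (hα : 0 < α) (hαβ : α ≤ β) :
    ∃ C : ℝ, 0 < C ∧ ∀ (a : (Fin d → ℤ) → (Fin d → ℤ) → ℝ), IsConductivity α β a →
      ∀ (T : ℝ), 0 < T → ∀ (y : Fin d → ℤ) (w ψ : (Fin d → ℤ) → ℝ) (S : Finset (Fin d → ℤ)),
      IsSubsolution T a y w → (∀ x, 0 ≤ w x) → IsCutoffProfile S y ψ →
      ∀ s t : ℝ, 0 < s → 0 ≤ t →
        ∑ x ∈ superlevel S ψ (t + s), w x ^ 2 ≤ C / s ^ d * (∑ x ∈ superlevel S ψ t, w x) ^ 2 := by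
  have hβ : 0 < β := hα.trans_le hαβ
  set K : ℝ := 2 ^ d * (4 * d * β / α) with hK
  have hK0 : 0 ≤ K := by positivity
  -- The Nash scale will be $L=\lfloor\varepsilon s\rfloor$. The choice of $\varepsilon$ makes
  -- $K(2\varepsilon)^2 2^d\le 1/2$, so that the $\ell^2$ term is absorbed, and $4\varepsilon\le1$,
  -- so that $\varepsilon s\ge1$ implies $s/2\ge2$.
  set ε : ℝ := 1 / (4 * (K + 1) * 2 ^ d) with hε
  have hε0 : 0 < ε := by positivity
  have h2d : (1 : ℝ) ≤ 2 ^ d := one_le_pow₀ (by norm_num)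
  have hε4 : 4 * ε ≤ 1 := by
    rw [hε, mul_one_div, div_le_one (by positivity)]
    nlinarith
  have hKε : K * (2 * ε) ^ 2 * 2 ^ d ≤ 1 / 2 := by
    have h1 : K * ε * 2 ^ d ≤ 1 / 4 := by
      rw [hε, mul_one_div, div_mul_eq_mul_div, div_le_div_iff₀ (by positivity) (by norm_num)]
      nlinarith
    have h2 : K * (2 * ε) ^ 2 * 2 ^ d = K * ε * 2 ^ d * (4 * ε) := by ring
    rw [h2]
    nlinarith [mul_nonneg (mul_nonneg hK0 hε0.le) (by positivity : (0 : ℝ) ≤ 2 ^ d)]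
  refine ⟨2 * (2 / ε) ^ d, by positivity, ?_⟩
  intro a ha T hT y w ψ S hw hw0 hψ
  -- Induction on the dyadic size of $\varepsilon s$. The outer half of the gap $s$ is treated by
  -- the induction hypothesis, which loses $2^d$, and the inner half by Nash. For $\varepsilon s<1$
  -- the embedding $\ell^1\subset\ell^2$ on the lattice suffices.
  have key : ∀ n : ℕ, ∀ s t : ℝ, 0 < s → ε * s < 2 ^ n → 0 ≤ t →
      ∑ x ∈ superlevel S ψ (t + s), w x ^ 2
        ≤ 2 * (2 / ε) ^ d / s ^ d * (∑ x ∈ superlevel S ψ t, w x) ^ 2 := by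
    have base : ∀ s t : ℝ, 0 < s → ε * s < 1 → 0 ≤ t →
        ∑ x ∈ superlevel S ψ (t + s), w x ^ 2
          ≤ 2 * (2 / ε) ^ d / s ^ d * (∑ x ∈ superlevel S ψ t, w x) ^ 2 := by
      intro s t hs hs1 ht
      have h1 : 1 ≤ 2 * (2 / ε) ^ d / s ^ d := by
        rw [mul_div_assoc, ← div_pow]
        have : 1 ≤ 2 / ε / s := by
          rw [div_div, le_div_iff₀ (by positivity)]
          linarith
        linarith [one_le_pow₀ this (n := d)]
      calc ∑ x ∈ superlevel S ψ (t + s), w x ^ 2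
          ≤ ∑ x ∈ superlevel S ψ t, w x ^ 2 :=
            sum_superlevel_anti (by linarith) fun x => sq_nonneg _
        _ ≤ (∑ x ∈ superlevel S ψ t, w x) ^ 2 :=
            Finset.sum_sq_le_sq_sum_of_nonneg fun x _ => hw0 x
        _ ≤ _ := le_mul_of_one_le_left (sq_nonneg _) h1
    intro n
    induction n with
    | zero => simpa using base
    | succ n ih =>
      intro s t hs hsn ht
      rcases lt_or_ge (ε * s) 1 with h | h
      · exact base s t hs h ht
      set M := ∑ x ∈ superlevel S ψ t, w x
      have hL : 1 ≤ ⌊ε * s⌋₊ := Nat.one_le_floor_iff _ |>.2 h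
      have hL1 : (⌊ε * s⌋₊ : ℝ) ≤ ε * s := Nat.floor_le (by positivity)
      have hL2 : ε * s / 2 ≤ (⌊ε * s⌋₊ : ℝ) := by
        have h3 := Nat.lt_floor_add_one (ε * s)
        have h4 : (1 : ℝ) ≤ (⌊ε * s⌋₊ : ℝ) := by exact_mod_cast hL
        linarith
      have hs4 : 2 ≤ s / 2 := by nlinarith
      have h1 := hw.sum_sq_le_nash hw0 hα hαβ hT ha hψ (t := t + s / 2) (by linarith) hs4 hL
      have h2 := ih (s / 2) t (by linarith) (by rw [pow_succ] at hsn; linarith) ht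
      have h3 : ∑ x ∈ superlevel S ψ (t + s / 2), w x ≤ M := sum_superlevel_anti (by linarith) hw0
      have h3' : 0 ≤ ∑ x ∈ superlevel S ψ (t + s / 2), w x := Finset.sum_nonneg fun x _ => hw0 x
      rw [add_assoc, add_halves, ← hK] at h1
      have h4 : K * (⌊ε * s⌋₊ / (s / 2)) ^ 2 ≤ K * (2 * ε) ^ 2 := by
        gcongr
        rw [div_le_iff₀ (by positivity)]
        linarith
      have h5 : ((⌊ε * s⌋₊ : ℝ) ^ d)⁻¹ ≤ (2 / ε) ^ d / s ^ d := by
        rw [← div_pow, ← inv_pow]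
        have : (⌊ε * s⌋₊ : ℝ)⁻¹ ≤ 2 / ε / s := by
          rw [inv_le_comm₀ (by linarith [mul_pos hε0 hs]) (by positivity)]
          refine le_trans (le_of_eq ?_) hL2
          field_simp
        gcongr
      have h6 : 2 * (2 / ε) ^ d / (s / 2) ^ d = 2 ^ d * (2 * (2 / ε) ^ d / s ^ d) := by
        rw [div_pow s 2]
        field_simp
      calc ∑ x ∈ superlevel S ψ (t + s), w x ^ 2
          ≤ (2 / ε) ^ d / s ^ d * M ^ 2
            + K * (2 * ε) ^ 2 * (2 * (2 / ε) ^ d / (s / 2) ^ d * M ^ 2) := by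
            refine h1.trans (add_le_add ?_ ?_)
            · gcongr
            · exact mul_le_mul h4 h2 (Finset.sum_nonneg fun x _ => sq_nonneg _) (by positivity)
        _ = (2 / ε) ^ d / s ^ d * M ^ 2
            + (K * (2 * ε) ^ 2 * 2 ^ d) * (2 * (2 / ε) ^ d / s ^ d * M ^ 2) := by
            rw [h6]
            ring
        _ ≤ (2 / ε) ^ d / s ^ d * M ^ 2 + (1 / 2) * (2 * (2 / ε) ^ d / s ^ d * M ^ 2) := by
            gcongr
        _ = _ := by ring
  intro s t hs ht
  obtain ⟨n, hn⟩ := pow_unbounded_of_one_lt (ε * s) (one_lt_two (α := ℝ))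
  exact key n s t hs hn ht

/-- Iterated reverse Hölder inequality: `L¹` controls `L^{2^m}` on smaller sets. -/
theorem exists_sum_pow_two_pow_le (d : ℕ) {α β : ℝ} (hα : 0 < α) (hαβ : α ≤ β) (m : ℕ) :
    ∃ C : ℝ, 0 < C ∧ ∀ (a : (Fin d → ℤ) → (Fin d → ℤ) → ℝ), IsConductivity α β a →
      ∀ (T : ℝ), 0 < T → ∀ (y : Fin d → ℤ) (w ψ : (Fin d → ℤ) → ℝ) (S : Finset (Fin d → ℤ)),
      IsSubsolution T a y w → (∀ x, 0 ≤ w x) → IsCutoffProfile S y ψ →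
      ∀ s t : ℝ, 0 < s → 0 ≤ t →
        ∑ x ∈ superlevel S ψ (t + m * s), w x ^ 2 ^ m
          ≤ C * s ^ d * ((∑ x ∈ superlevel S ψ t, w x) / s ^ d) ^ 2 ^ m := by
  obtain ⟨C₀, hC₀, h⟩ := exists_sum_sq_le_sum d hα hαβ
  induction m with
  | zero =>
    refine ⟨1, one_pos, fun a ha T hT y w ψ S hw hw0 hψ s t hs ht => le_of_eq ?_⟩
    simp only [Nat.cast_zero, zero_mul, add_zero, pow_zero, pow_one, one_mul]
    field_simp
  | succ m ih =>
    obtain ⟨C, hC, ih⟩ := ih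
    refine ⟨C₀ * C ^ 2, by positivity, fun a ha T hT y w ψ S hw hw0 hψ s t hs ht => ?_⟩
    have h1 := ih a ha T hT y w ψ S hw hw0 hψ s t hs ht
    have h2 := h a ha T hT y (fun x => w x ^ 2 ^ m) ψ S (hw.pow_two_pow hw0 hT hα ha m)
      (fun x => pow_nonneg (hw0 x) _) hψ s (t + m * s) hs (by positivity)
    have e1 : t + ((m + 1 : ℕ) : ℝ) * s = t + m * s + s := by
      push_cast
      ring
    set l := (∑ x ∈ superlevel S ψ t, w x) / s ^ d
    rw [e1]
    calc ∑ x ∈ superlevel S ψ (t + m * s + s), w x ^ 2 ^ (m + 1)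
        = ∑ x ∈ superlevel S ψ (t + m * s + s), (w x ^ 2 ^ m) ^ 2 := by
          simp only [← pow_mul, ← pow_succ]
      _ ≤ C₀ / s ^ d * (∑ x ∈ superlevel S ψ (t + m * s), w x ^ 2 ^ m) ^ 2 := h2
      _ ≤ C₀ / s ^ d * (C * s ^ d * l ^ 2 ^ m) ^ 2 := by
          have : 0 ≤ ∑ x ∈ superlevel S ψ (t + m * s), w x ^ 2 ^ m :=
            Finset.sum_nonneg fun x _ => pow_nonneg (hw0 x) _
          gcongr
      _ = C₀ * C ^ 2 * s ^ d * l ^ 2 ^ (m + 1) := by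
          rw [pow_succ 2 m, pow_mul l]
          field_simp

end ReverseHolder

/-! ### Lattice geometry and the passage from $L^1$ to $L^q$ on annuli. -/

section Annulus

variable {d : ℕ}

theorem latticeNorm_eq_norm (x : Fin d → ℤ) :
    latticeNorm x = ‖(WithLp.toLp 2 (fun i => (x i : ℝ)) : EuclideanSpace ℝ (Fin d))‖ := by
  simp [latticeNorm, EuclideanSpace.norm_eq]

theorem latticeNorm_zero : latticeNorm (0 : Fin d → ℤ) = 0 := by simp [latticeNorm]

theorem latticeNorm_add_le (x z : Fin d → ℤ) :
    latticeNorm (x + z) ≤ latticeNorm x + latticeNorm z := by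
  simp only [latticeNorm_eq_norm]
  refine le_trans (le_of_eq ?_) (norm_add_le _ _)
  congr 1
  ext i
  simp

theorem latticeNorm_neg (x : Fin d → ℤ) : latticeNorm (-x) = latticeNorm x := by
  simp [latticeNorm]

theorem latticeNorm_latticeBasis (i : Fin d) : latticeNorm (latticeBasis i : Fin d → ℤ) = 1 := by
  have h := latticeNorm_basis (0 : Fin d → ℤ) i
  rwa [zero_add, zero_sub, latticeNorm_neg] at h

theorem abs_latticeNorm_add_basis_sub_le (x y : Fin d → ℤ) (i : Fin d) :
    |latticeNorm (x + latticeBasis i - y) - latticeNorm (x - y)| ≤ 1 := by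
  have h1 := latticeNorm_add_le (x - y) (latticeBasis i)
  have h2 := latticeNorm_add_le (x + latticeBasis i - y) (-latticeBasis i)
  rw [latticeNorm_neg, latticeNorm_latticeBasis] at h2
  rw [latticeNorm_latticeBasis] at h1
  have e1 : x - y + latticeBasis i = x + latticeBasis i - y := by abel
  have e2 : x + latticeBasis i - y + -latticeBasis i = x - y := by abel
  rw [e1] at h1
  rw [e2] at h2
  rw [abs_le]
  constructor <;> linarith

theorem abs_le_latticeNorm (x : Fin d → ℤ) (i : Fin d) : |(x i : ℝ)| ≤ latticeNorm x :=
  Real.abs_le_sqrt (Finset.single_le_sum (f := fun k => (x k : ℝ) ^ 2)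
    (fun _ _ => sq_nonneg _) (Finset.mem_univ i))

theorem one_le_latticeNorm {x : Fin d → ℤ} (hx : x ≠ 0) : 1 ≤ latticeNorm x := by
  obtain ⟨i, hi⟩ := Function.ne_iff.1 hx
  refine le_trans ?_ (abs_le_latticeNorm x i)
  exact_mod_cast Int.one_le_abs hi

theorem card_latticeBall_le (y : Fin d → ℤ) {R : ℝ} (hR : 0 ≤ R) :
    ((latticeBall y R).card : ℝ) ≤ (2 * R + 1) ^ d := by
  have hsub : latticeBall y R
      ⊆ Fintype.piFinset fun i => Finset.Icc (y i - ⌊R⌋₊) (y i + ⌊R⌋₊) := by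
    intro x hx
    rw [Fintype.mem_piFinset]
    intro i
    have h1 : |((x i - y i : ℤ) : ℝ)| ≤ R :=
      (abs_le_latticeNorm (x - y) i).trans (mem_latticeBall.1 hx)
    have h2 : |x i - y i| ≤ (⌊R⌋₊ : ℤ) := by
      rw [Int.natCast_floor_eq_floor hR, Int.le_floor]
      exact_mod_cast h1
    rw [abs_le] at h2
    rw [Finset.mem_Icc]
    constructor <;> linarith
  have h1 := Finset.card_le_card hsub
  have h2 : ∀ i, (Finset.Icc (y i - (⌊R⌋₊ : ℤ)) (y i + ⌊R⌋₊)).card = 2 * ⌊R⌋₊ + 1 := fun i => by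
    rw [Int.card_Icc]
    omega
  rw [Fintype.card_piFinset, Finset.prod_congr rfl fun i _ => h2 i, Finset.prod_const,
    Finset.card_univ, Fintype.card_fin] at h1
  have h3 : (⌊R⌋₊ : ℝ) ≤ R := Nat.floor_le hR
  calc ((latticeBall y R).card : ℝ) ≤ ((2 * ⌊R⌋₊ + 1 : ℕ) : ℝ) ^ d := by exact_mod_cast h1
    _ ≤ _ := by
      push_cast
      gcongr

/-- The profile whose superlevel sets are annuli around `y` at scale `R`. -/
noncomputable def annulusProfile (y : Fin d → ℤ) (R : ℝ) (x : Fin d → ℤ) : ℝ :=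
  min (latticeNorm (x - y)) (4 * R - latticeNorm (x - y)) - R / 4

theorem isCutoffProfile_annulusProfile (y : Fin d → ℤ) {R : ℝ} (hR : 0 < R) :
    IsCutoffProfile (latticeBall y (4 * R)) y (annulusProfile y R) where
  abs_grad_le x i := by
    have h := abs_latticeNorm_add_basis_sub_le x y i
    simp only [latticeGrad, annulusProfile]
    rw [sub_sub_sub_cancel_right]
    refine (abs_min_sub_min_le_max _ _ _ _).trans (max_le h ?_)
    rw [sub_sub_sub_cancel_left, abs_sub_comm]
    exact h
  mem_of_nonneg x hx := by
    rw [mem_latticeBall]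
    have := min_le_right (latticeNorm (x - y)) (4 * R - latticeNorm (x - y))
    rw [annulusProfile] at hx
    linarith
  neg := by
    rw [annulusProfile, sub_self, latticeNorm_zero, sub_zero, min_eq_left (by linarith)]
    linarith

theorem latticeAnnulus_subset_superlevel (y : Fin d → ℤ) {R : ℝ} (hR : 0 < R) :
    latticeAnnulus y R ⊆ superlevel (latticeBall y (4 * R)) (annulusProfile y R) (3 * R / 4) := by
  intro x hx
  rw [mem_latticeAnnulus] at hx
  rw [(isCutoffProfile_annulusProfile y hR).mem_superlevel (by positivity), annulusProfile]
  have : R ≤ min (latticeNorm (x - y)) (4 * R - latticeNorm (x - y)) :=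
    le_min hx.1 (by linarith)
  linarith

/-- `L¹` controls `L^q` on annuli, for nonnegative subsolutions. -/
theorem exists_sum_latticeAnnulus_rpow_le (d : ℕ) {α β : ℝ} (hα : 0 < α) (hαβ : α ≤ β) {q : ℝ}
    (hq : 1 ≤ q) :
    ∃ C : ℝ, 0 < C ∧ ∀ (a : (Fin d → ℤ) → (Fin d → ℤ) → ℝ), IsConductivity α β a →
      ∀ (T : ℝ), 0 < T → ∀ (y : Fin d → ℤ) (w : (Fin d → ℤ) → ℝ),
      IsSubsolution T a y w → (∀ x, 0 ≤ w x) → ∀ R : ℝ, 0 < R →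
        ∑ x ∈ latticeAnnulus y R, w x ^ q ≤ C * R ^ d * ((∑ x ∈ superlevel
          (latticeBall y (4 * R)) (annulusProfile y R) (R / 4), w x) / R ^ d) ^ q := by
  obtain ⟨m, hm⟩ := pow_unbounded_of_one_lt q (one_lt_two (α := ℝ))
  have hm0 : 0 < m := by
    rcases Nat.eq_zero_or_pos m with h | h
    · subst h
      simp at hm
      linarith
    · exact h
  have hmR : (0 : ℝ) < m := by exact_mod_cast hm0
  obtain ⟨C, hC, h⟩ := exists_sum_pow_two_pow_le d hα hαβ m
  refine ⟨(10 ^ d + C * (1 / (2 * m)) ^ d) * ((2 * m) ^ d) ^ q, by positivity,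
    fun a ha T hT y w hw hw0 R hR => ?_⟩
  set S := latticeBall y (4 * R)
  set ψ := annulusProfile y R
  have hψ : IsCutoffProfile S y ψ := isCutoffProfile_annulusProfile y hR
  set M := ∑ x ∈ superlevel S ψ (R / 4), w x
  have hM : 0 ≤ M := Finset.sum_nonneg fun x _ => hw0 x
  -- With this width, $m$ Moser steps lead from level $R/4$ to level $3R/4$, which still contains
  -- the annulus.
  set s := R / (2 * m)
  have hs : 0 < s := by positivity
  have hms : R / 4 + m * s = 3 * R / 4 := by
    simp only [s]
    field_simp
    ring
  have h1 := h a ha T hT y w ψ S hw hw0 hψ s (R / 4) hs (by positivity)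
  rw [hms] at h1
  have hsub : latticeAnnulus y R ⊆ superlevel S ψ (3 * R / 4) :=
    latticeAnnulus_subset_superlevel y hR
  have hcard : ((latticeAnnulus y R).card : ℝ) ≤ 10 ^ d * R ^ d := by
    -- For $R<1/2$ the annulus is empty, since $2R<1$ leaves only the center, which lies at distance
    -- $0<R$.
    rcases lt_or_ge R (1 / 2) with hR2 | hR2
    · have : latticeAnnulus y R = ∅ := by
        rw [Finset.eq_empty_iff_forall_notMem]
        intro x hx
        rw [mem_latticeAnnulus] at hx
        have h2 : x - y ≠ 0 := fun h0 => by
          rw [h0, latticeNorm_zero] at hx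
          linarith
        have := one_le_latticeNorm h2
        linarith
      rw [this]
      simp
      positivity
    · calc ((latticeAnnulus y R).card : ℝ) ≤ (S.card : ℝ) := by
            exact_mod_cast Finset.card_le_card (hsub.trans (Finset.filter_subset _ _))
        _ ≤ (2 * (4 * R) + 1) ^ d := card_latticeBall_le y (by positivity)
        _ ≤ (10 * R) ^ d := by
            gcongr
            linarith
        _ = _ := mul_pow _ _ _
  have hsd : s ^ d = (1 / (2 * m)) ^ d * R ^ d := by
    rw [← mul_pow]
    congr 1
    simp only [s]
    ring
  rcases hM.eq_or_lt with hM0 | hMpos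
  · have hz : ∀ x ∈ latticeAnnulus y R, w x ^ q = 0 := fun x hx => by
      have hx' : x ∈ superlevel S ψ (R / 4) := superlevel_anti (by linarith) (hsub hx)
      have := (Finset.sum_eq_zero_iff_of_nonneg fun x _ => hw0 x).1 hM0.symm x hx'
      rw [this, Real.zero_rpow (by linarith)]
    rw [Finset.sum_eq_zero hz]
    positivity
  · set l := M / s ^ d
    have hl : 0 < l := by positivity
    -- As $q<2^m$, the power $q$ is interpolated between 0 and $2^m$ after normalizing by the mean
    -- value $l$.
    have hpt : ∀ z : ℝ, 0 ≤ z → z ^ q ≤ l ^ q * (1 + z ^ 2 ^ m / l ^ 2 ^ m) := by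
      intro z hz
      have hzl : 0 ≤ z / l := by positivity
      have h2 : (z / l) ^ q ≤ 1 + (z / l) ^ 2 ^ m := by
        rcases le_total (z / l) 1 with h3 | h3
        · have := Real.rpow_le_one hzl h3 (by linarith : 0 ≤ q)
          have h4 : 0 ≤ (z / l) ^ 2 ^ m := by positivity
          linarith
        · have h4 := Real.rpow_le_rpow_of_exponent_le h3 hm.le
          have h5 : (z / l) ^ ((2 : ℝ) ^ m) = (z / l) ^ 2 ^ m := by
            rw [← Real.rpow_natCast]
            norm_cast
          linarith
      calc z ^ q = l ^ q * (z / l) ^ q := by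
            rw [← Real.mul_rpow hl.le hzl]
            congr 1
            field_simp
        _ ≤ l ^ q * (1 + (z / l) ^ 2 ^ m) := by gcongr
        _ = _ := by rw [div_pow]
    calc ∑ x ∈ latticeAnnulus y R, w x ^ q
        ≤ ∑ x ∈ latticeAnnulus y R, l ^ q * (1 + w x ^ 2 ^ m / l ^ 2 ^ m) :=
          Finset.sum_le_sum fun x _ => hpt _ (hw0 x)
      _ = l ^ q * ((latticeAnnulus y R).card
            + (∑ x ∈ latticeAnnulus y R, w x ^ 2 ^ m) / l ^ 2 ^ m) := by
          rw [← Finset.mul_sum, Finset.sum_add_distrib, Finset.sum_div]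
          simp
      _ ≤ l ^ q * (10 ^ d * R ^ d + C * s ^ d) := by
          gcongr
          rw [div_le_iff₀ (by positivity)]
          exact (Finset.sum_le_sum_of_subset_of_nonneg hsub
            fun x _ _ => pow_nonneg (hw0 x) _).trans h1
      _ = _ := by
          have hl2 : l = (2 * m) ^ d * (M / R ^ d) := by
            simp only [l]
            rw [hsd, div_pow, one_pow]
            field_simp
          rw [hl2, Real.mul_rpow (by positivity) (by positivity), hsd]
          ring

end Annulus

/-! ### Decay of the Green's function beyond the scale $\sqrt T$. -/

section Decay

/-- A bound for the `L¹` norm on an annulus, in units of the natural scale `R²`, yields the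
corresponding `L^q` bound on a smaller annulus. -/
theorem exists_sum_latticeAnnulus_rpow_le_of_sum_le (d : ℕ) {α β : ℝ} (hα : 0 < α) (hαβ : α ≤ β)
    {q : ℝ} (hq : 1 ≤ q) :
    ∃ C : ℝ, 0 < C ∧ ∀ (a : (Fin d → ℤ) → (Fin d → ℤ) → ℝ), IsConductivity α β a →
      ∀ (T : ℝ), 0 < T → ∀ (y : Fin d → ℤ) (w : (Fin d → ℤ) → ℝ),
      IsSubsolution T a y w → (∀ x, 0 ≤ w x) → ∀ R : ℝ, 0 < R → ∀ B : ℝ, 0 ≤ B →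
        ∑ x ∈ superlevel (latticeBall y (4 * R)) (annulusProfile y R) (R / 4), w x ≤ B * R ^ 2 →
        ∑ x ∈ latticeAnnulus y R, w x ^ q
          ≤ C * B ^ q * (R ^ (d : ℝ) * (R ^ (2 - d : ℝ)) ^ q) := by
  obtain ⟨C, hC, h⟩ := exists_sum_latticeAnnulus_rpow_le d hα hαβ hq
  refine ⟨C, hC, fun a ha T hT y w hw hw0 R hR B hB hM => ?_⟩
  refine (h a ha T hT y w hw hw0 R hR).trans ?_
  have e1 : B * R ^ 2 / R ^ d = B * R ^ (2 - d : ℝ) := by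
    rw [Real.rpow_sub hR, Real.rpow_natCast, mul_div_assoc]
    norm_cast
  calc _ ≤ C * R ^ d * (B * R ^ 2 / R ^ d) ^ q := by
        have : 0 ≤ ∑ x ∈ superlevel (latticeBall y (4 * R)) (annulusProfile y R) (R / 4), w x :=
          Finset.sum_nonneg fun x _ => hw0 x
        gcongr
    _ = _ := by
        rw [e1, Real.mul_rpow hB (by positivity), Real.rpow_natCast]
        ring

/-- Iterating the Caccioppoli inequality: decay of the `L²` norm between superlevel sets. -/
theorem IsSubsolution.sum_sq_iterate_le {d : ℕ} {α β T : ℝ}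
    {a : (Fin d → ℤ) → (Fin d → ℤ) → ℝ} {y : Fin d → ℤ} {w ψ : (Fin d → ℤ) → ℝ}
    {S : Finset (Fin d → ℤ)} (hw : IsSubsolution T a y w) (hw0 : ∀ x, 0 ≤ w x)
    (hα : 0 < α) (hαβ : α ≤ β) (hT : 0 < T) (ha : IsConductivity α β a)
    (hψ : IsCutoffProfile S y ψ) {s t : ℝ} (ht : 0 ≤ t) (hs : 2 ≤ s) (k : ℕ) :
    ∑ x ∈ superlevel S ψ (t + k * s), w x ^ 2
      ≤ (4 * d * β * T / s ^ 2) ^ k * ∑ x ∈ superlevel S ψ t, w x ^ 2 := by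
  have hβ : 0 < β := hα.trans_le hαβ
  induction k with
  | zero => simp
  | succ k ih =>
    have e1 : t + ((k + 1 : ℕ) : ℝ) * s = t + k * s + s := by
      push_cast
      ring
    have h1 := (hw.exists_localization hw0 hα hαβ hT ha hψ (t := t + k * s)
      (by positivity) hs).1
    rw [inv_mul_eq_div, div_le_iff₀ hT] at h1
    rw [e1]
    calc _ ≤ _ := h1
      _ = 4 * d * β * T / s ^ 2 * ∑ x ∈ superlevel S ψ (t + k * s), w x ^ 2 := by ring
      _ ≤ 4 * d * β * T / s ^ 2
          * ((4 * d * β * T / s ^ 2) ^ k * ∑ x ∈ superlevel S ψ t, w x ^ 2) := by gcongr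
      _ = _ := by rw [pow_succ]; ring

/-- Decay of the `L¹` norm of the Green's function on annuli beyond the scale `√T`. -/
theorem exists_sum_superlevel_le_decay (d : ℕ) {α β : ℝ} (hα : 0 < α) (hαβ : α ≤ β) (n : ℕ) :
    ∃ C : ℝ, 0 < C ∧ ∀ (a : (Fin d → ℤ) → (Fin d → ℤ) → ℝ), IsConductivity α β a →
      ∀ (T : ℝ), 0 < T → ∀ (y : Fin d → ℤ) (u : (Fin d → ℤ) → ℝ), IsGreenFunction T a y u →
      ∀ R : ℝ, 32 * (n + 1) ≤ R →
        ∑ x ∈ superlevel (latticeBall y (4 * R)) (annulusProfile y R) (R / 4), u x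
          ≤ C * T * (T / R ^ 2) ^ (n + 1) := by
  have hβ : 0 < β := hα.trans_le hαβ
  obtain ⟨C, hC, h⟩ := exists_sum_sq_le_sum d hα hαβ
  set D : ℝ := 9 ^ d * ((4 * d * β * (16 * (n + 1)) ^ 2) ^ (2 * (n + 1)) * (C * 8 ^ d)) with hD
  have hD0 : 0 ≤ D := by positivity
  refine ⟨√D + 1, by positivity, fun a ha T hT y u hu R hR => ?_⟩
  have hn0 : (0 : ℝ) ≤ n := Nat.cast_nonneg n
  have hR1 : 1 ≤ R := by linarith
  have hR0 : 0 < R := by linarith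
  set S := latticeBall y (4 * R)
  set ψ := annulusProfile y R
  have hψ : IsCutoffProfile S y ψ := isCutoffProfile_annulusProfile y hR0
  have hu0 := hu.nonneg hα hT ha
  -- Then $2(n+1)$ Caccioppoli steps lead from level $R/8$ to level $R/4$; the lower bound on $R$ is
  -- what makes $s\ge2$. The levels from 0 to $R/8$ are kept for the reverse Hölder inequality,
  -- which starts from the mass bound $T$.
  set s := R / (16 * (n + 1)) with hs
  have hs2 : 2 ≤ s := by
    rw [hs, le_div_iff₀ (by positivity)]
    linarith
  have h1 := hu.isSubsolution.sum_sq_iterate_le hu0 hα hαβ hT ha hψ (t := R / 8) (by positivity)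
    hs2 (2 * (n + 1))
  have e1 : R / 8 + ((2 * (n + 1) : ℕ) : ℝ) * s = R / 4 := by
    rw [hs]
    push_cast
    field_simp
    ring
  rw [e1] at h1
  have h2 := h a ha T hT y u ψ S hu.isSubsolution hu0 hψ (R / 8) 0 (by positivity) le_rfl
  rw [zero_add] at h2
  have h3 : ∑ x ∈ superlevel S ψ 0, u x ≤ T := hu.sum_le hα hT ha _
  have h3' : 0 ≤ ∑ x ∈ superlevel S ψ 0, u x := Finset.sum_nonneg fun x _ => hu0 x
  have hcard : ((superlevel S ψ (R / 4)).card : ℝ) ≤ (9 * R) ^ d := by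
    calc ((superlevel S ψ (R / 4)).card : ℝ) ≤ (S.card : ℝ) := by
          exact_mod_cast Finset.card_le_card (Finset.filter_subset _ _)
      _ ≤ (2 * (4 * R) + 1) ^ d := card_latticeBall_le y (by positivity)
      _ ≤ (9 * R) ^ d := by
          gcongr
          linarith
  have h4 : (∑ x ∈ superlevel S ψ (R / 4), u x) ^ 2 ≤ D * (T * (T / R ^ 2) ^ (n + 1)) ^ 2 := by
    calc (∑ x ∈ superlevel S ψ (R / 4), u x) ^ 2
        ≤ (superlevel S ψ (R / 4)).card * ∑ x ∈ superlevel S ψ (R / 4), u x ^ 2 :=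
          sq_sum_le_card_mul_sum_sq
      _ ≤ (9 * R) ^ d * ((4 * d * β * T / s ^ 2) ^ (2 * (n + 1)) * (C / (R / 8) ^ d * T ^ 2)) := by
          have h5 : ∑ x ∈ superlevel S ψ (R / 8), u x ^ 2 ≤ C / (R / 8) ^ d * T ^ 2 := by
            refine h2.trans ?_
            gcongr
          have h6 : 0 ≤ (4 * d * β * T / s ^ 2) ^ (2 * (n + 1)) := by positivity
          exact mul_le_mul hcard (h1.trans (mul_le_mul_of_nonneg_left h5 h6))
            (Finset.sum_nonneg fun x _ => sq_nonneg _) (by positivity)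
      _ = D * (T * (T / R ^ 2) ^ (n + 1)) ^ 2 := by
          have e2 : 4 * d * β * T / s ^ 2 = 4 * d * β * (16 * (n + 1)) ^ 2 * (T / R ^ 2) := by
            rw [hs]
            field_simp
          have e3 : C / (R / 8) ^ d = C * 8 ^ d / R ^ d := by
            rw [div_pow]
            field_simp
          rw [e2, e3, hD, mul_pow, mul_pow, mul_pow T, ← pow_mul, mul_comm (n + 1) 2]
          field_simp
  have h5 : 0 ≤ T * (T / R ^ 2) ^ (n + 1) := by positivity
  have h6 : ∑ x ∈ superlevel S ψ (R / 4), u x ≤ √D * (T * (T / R ^ 2) ^ (n + 1)) := by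
    refine abs_le_of_sq_le_sq' ?_ (by positivity) |>.2
    rw [mul_pow, Real.sq_sqrt hD0]
    exact h4
  linarith

/-- Decay of the `L^q` norm of the Green's function on annuli beyond the scale `√T`. -/
theorem exists_sum_latticeAnnulus_rpow_le_decay (d : ℕ) {α β : ℝ} (hα : 0 < α) (hαβ : α ≤ β)
    {q r : ℝ} (hq : 1 ≤ q) (hr : 0 ≤ r) :
    ∃ R₁ : ℝ, 1 ≤ R₁ ∧ ∀ T₀ : ℝ, 0 < T₀ → ∃ C : ℝ, 0 < C ∧
      ∀ a : (Fin d → ℤ) → (Fin d → ℤ) → ℝ, IsConductivity α β a →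
      ∀ T : ℝ, 0 < T → ∀ (y : Fin d → ℤ) (u : (Fin d → ℤ) → ℝ), IsGreenFunction T a y u →
      ∀ R : ℝ, √T ≤ R → (T₀ ≤ T ∨ R₁ ≤ R) →
        ∑ x ∈ latticeAnnulus y R, u x ^ q
          ≤ C * (R ^ (d : ℝ) * (R ^ (2 - d : ℝ)) ^ q * (√T / R) ^ r) := by
  set n : ℕ := ⌈r⌉₊
  have hn : r ≤ n := Nat.le_ceil r
  have hn0 : (0 : ℝ) ≤ n := Nat.cast_nonneg n
  obtain ⟨C₁, hC₁, hA⟩ := exists_sum_latticeAnnulus_rpow_le_of_sum_le d hα hαβ hq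
  obtain ⟨C₂, hC₂, hB⟩ := exists_sum_superlevel_le_decay d hα hαβ n
  refine ⟨32 * (n + 1), by linarith, fun T₀ hT₀ => ?_⟩
  set R₁ : ℝ := 32 * (n + 1)
  have hR₁ : 0 < R₁ := by positivity
  refine ⟨C₁ * C₂ ^ q + C₁ * (R₁ / √T₀) ^ r, by positivity, fun a ha T hT y u hu R hTR hcase => ?_⟩
  have hu0 := hu.nonneg hα hT ha
  have hsT : 0 < √T := Real.sqrt_pos.2 hT
  have hR : 0 < R := hsT.trans_le hTR
  set ρ := √T / R with hρ
  have hρ0 : 0 < ρ := by positivity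
  have hρ1 : ρ ≤ 1 := (div_le_one hR).2 hTR
  have hTρ : T / R ^ 2 = ρ ^ 2 := by rw [hρ, div_pow, Real.sq_sqrt hT.le]
  have hTeq : T = ρ ^ 2 * R ^ 2 := by rw [← hTρ]; field_simp
  set X := R ^ (d : ℝ) * (R ^ (2 - d : ℝ)) ^ q
  have hX : 0 ≤ X := by positivity
  have hρr : 0 < ρ ^ r := by positivity
  -- If $R<R_1$, then $T\ge T_0$ bounds $\sqrt T/R$ below by $\sqrt{T_0}/R_1$, so the decay factor
  -- costs only a constant and the mass bound $T\le R^2$ is enough.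
  rcases le_or_gt R₁ R with h | h
  · have h1 := hB a ha T hT y u hu R h
    have h2 := hA a ha T hT y u hu.isSubsolution hu0 R hR (C₂ * ρ ^ (2 * (n + 2))) (by positivity)
      (h1.trans (le_of_eq (by
        rw [hTρ]
        nth_rewrite 1 [hTeq]
        rw [← pow_mul]
        ring)))
    have h3 : (C₂ * ρ ^ (2 * (n + 2))) ^ q ≤ C₂ ^ q * ρ ^ r := by
      rw [Real.mul_rpow hC₂.le (by positivity), ← Real.rpow_natCast ρ, ← Real.rpow_mul hρ0.le]
      refine mul_le_mul_of_nonneg_left ?_ (by positivity)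
      refine Real.rpow_le_rpow_of_exponent_ge hρ0 hρ1 ?_
      push_cast
      nlinarith
    calc _ ≤ _ := h2
      _ ≤ C₁ * (C₂ ^ q * ρ ^ r) * X := by gcongr
      _ ≤ (C₁ * C₂ ^ q + C₁ * (R₁ / √T₀) ^ r) * (X * ρ ^ r) := by
        have : 0 ≤ C₁ * (R₁ / √T₀) ^ r * (X * ρ ^ r) := by positivity
        linarith
  · have hT' : T₀ ≤ T := hcase.resolve_right (not_le.2 h)
    have hsT₀ : 0 < √T₀ := Real.sqrt_pos.2 hT₀
    have h2 := hA a ha T hT y u hu.isSubsolution hu0 R hR 1 zero_le_one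
      ((hu.sum_le hα hT ha _).trans (by
        rw [hTeq]
        have : ρ ^ 2 ≤ 1 := pow_le_one₀ hρ0.le hρ1
        gcongr))
    have h3 : 1 ≤ (R₁ / √T₀) ^ r * ρ ^ r := by
      rw [← Real.mul_rpow (by positivity) hρ0.le]
      refine Real.one_le_rpow ?_ hr
      rw [hρ, div_mul_div_comm, le_div_iff₀ (by positivity), one_mul, mul_comm]
      exact mul_le_mul h.le (Real.sqrt_le_sqrt hT') hsT₀.le hR₁.le
    rw [Real.one_rpow, mul_one] at h2
    calc _ ≤ _ := h2
      _ ≤ C₁ * X * ((R₁ / √T₀) ^ r * ρ ^ r) := le_mul_of_one_le_right (by positivity) h3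
      _ ≤ (C₁ * C₂ ^ q + C₁ * (R₁ / √T₀) ^ r) * (X * ρ ^ r) := by
        have : 0 ≤ C₁ * C₂ ^ q * (X * ρ ^ r) := by positivity
        linarith

end Decay

/-! ### A dyadic layer-cake bound. -/

section LayerCake

theorem rpow_le_dyadic_sum {κ s q : ℝ} (hκ : 0 < κ) (hs : 0 ≤ s) (hq : 0 ≤ q) {J : ℕ}
    (hJ : s < 2 ^ J * κ) :
    s ^ q ≤ κ ^ q + ∑ j ∈ Finset.range J, if 2 ^ j * κ ≤ s then (2 ^ (j + 1) * κ) ^ q else 0 := by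
  have hnn : ∀ j : ℕ, 0 ≤ if 2 ^ j * κ ≤ s then (2 ^ (j + 1) * κ) ^ q else 0 := fun j => by
    split_ifs
    · positivity
    · exact le_rfl
  induction J with
  | zero =>
    rw [pow_zero, one_mul] at hJ
    simpa using Real.rpow_le_rpow hs hJ.le hq
  | succ J ih =>
    rw [Finset.sum_range_succ]
    rcases lt_or_ge s (2 ^ J * κ) with h | h
    · linarith [ih h, hnn J]
    · rw [if_pos h]
      have h1 := Real.rpow_le_rpow hs hJ.le hq
      have h2 : 0 ≤ κ ^ q := by positivity
      have h3 := Finset.sum_nonneg fun j (_ : j ∈ Finset.range J) => hnn j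
      linarith

/-- A dyadic layer-cake bound for finite sums. -/
theorem exists_sum_rpow_le_dyadic {ι : Type*} (F : Finset ι) {f : ι → ℝ} (hf : ∀ x, 0 ≤ f x)
    {κ q : ℝ} (hκ : 0 < κ) (hq : 0 ≤ q) :
    ∃ J : ℕ, ∑ x ∈ F, f x ^ q ≤ κ ^ q * F.card + ∑ j ∈ Finset.range J,
      (2 ^ (j + 1) * κ) ^ q * ((F.filter fun x => 2 ^ j * κ ≤ f x).card : ℝ) := by
  obtain ⟨J, hJ⟩ := pow_unbounded_of_one_lt ((∑ x ∈ F, f x) / κ) (one_lt_two (α := ℝ))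
  rw [div_lt_iff₀ hκ] at hJ
  refine ⟨J, ?_⟩
  calc ∑ x ∈ F, f x ^ q
      ≤ ∑ x ∈ F, (κ ^ q + ∑ j ∈ Finset.range J,
          if 2 ^ j * κ ≤ f x then (2 ^ (j + 1) * κ) ^ q else 0) :=
        Finset.sum_le_sum fun x hx => rpow_le_dyadic_sum hκ (hf x) hq
          ((Finset.single_le_sum (fun z _ => hf z) hx).trans_lt hJ)
    _ = _ := by
        rw [Finset.sum_add_distrib, Finset.sum_comm, Finset.sum_const, nsmul_eq_mul, mul_comm]
        congr 1
        refine Finset.sum_congr rfl fun j _ => ?_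
        rw [← Finset.sum_filter, Finset.sum_const, nsmul_eq_mul, mul_comm]

end LayerCake

/-! ### Weak-type bound on level sets in dimension $d>2$. -/

section WeakType

variable {d : ℕ} {α β T : ℝ} {a : (Fin d → ℤ) → (Fin d → ℤ) → ℝ} {y : Fin d → ℤ}
  {u : (Fin d → ℤ) → ℝ}

theorem IsGreenFunction.finite_level (hu : IsGreenFunction T a y u) {k : ℝ} (hk : 0 < k) :
    {x | k ≤ u x}.Finite := by
  have h := (lp_two_summable_sq hu.memℓp).tendsto_cofinite_zero.eventually
    (gt_mem_nhds (show (0 : ℝ) < k ^ 2 by positivity))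
  rw [Filter.eventually_cofinite] at h
  refine h.subset fun x hx => ?_
  have hx' : k ≤ u x := hx
  simp only [Set.mem_ofPred_eq, not_lt]
  gcongr

theorem IsGreenFunction.mul_ncard_level_le (hu : IsGreenFunction T a y u) (hα : 0 < α)
    (hT : 0 < T) (ha : IsConductivity α β a) {k : ℝ} (hk : 0 < k) :
    k * ({x | k ≤ u x}.ncard : ℝ) ≤ T := by
  have hfin := hu.finite_level hk
  rw [Set.ncard_eq_toFinset_card _ hfin]
  calc k * (hfin.toFinset.card : ℝ) = ∑ x ∈ hfin.toFinset, k := by simp [mul_comm]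
    _ ≤ ∑ x ∈ hfin.toFinset, u x := Finset.sum_le_sum fun x hx => by simpa using hx
    _ ≤ T := hu.sum_le hα hT ha _

/-- Supplies the Nash scale for a set of $N$ points: the lower bound lets the $\ell^1$ term be
absorbed, and the upper one follows by minimality of $L$, since $L\le2(L-1)$. -/
theorem exists_nat_pow_bounds {d N : ℕ} (hd : d ≠ 0) (hN : 1 ≤ N) :
    ∃ L : ℕ, 1 ≤ L ∧ 2 * N ≤ L ^ d ∧ L ^ d ≤ 2 ^ (d + 1) * N := by
  classical
  have hex : ∃ L : ℕ, 2 * N ≤ L ^ d := ⟨2 * N, Nat.le_self_pow hd _⟩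
  set L := Nat.find hex
  have h1 : 2 * N ≤ L ^ d := Nat.find_spec hex
  have hL : 2 ≤ L := by
    by_contra h
    have h2 : L ^ d ≤ 1 ^ d := Nat.pow_le_pow_left (by omega) d
    rw [one_pow] at h2
    omega
  have h3 : (L - 1) ^ d < 2 * N := not_le.1 (Nat.find_min hex (by omega : L - 1 < L))
  refine ⟨L, by omega, h1, ?_⟩
  calc L ^ d ≤ (2 * (L - 1)) ^ d := Nat.pow_le_pow_left (by omega) d
    _ = 2 ^ d * (L - 1) ^ d := mul_pow _ _ _
    _ ≤ 2 ^ d * (2 * N) := Nat.mul_le_mul_left _ h3.le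
    _ = _ := by ring

/-- Comparison of the sizes of consecutive level sets of the Green's function. -/
theorem IsGreenFunction.ncard_level_two_mul_le (hu : IsGreenFunction T a y u) (hd : d ≠ 0)
    (hα : 0 < α) (hT : 0 < T) (ha : IsConductivity α β a) {k : ℝ} (hk : 0 < k) :
    (k * ({x | 2 * k ≤ u x}.ncard : ℝ)) ^ d
      ≤ (2 ^ (d + 1) * α⁻¹) ^ d * (2 ^ (d + 1)) ^ 2 * ({x | k ≤ u x}.ncard : ℝ) ^ 2 := by
  have hfin := hu.finite_level hk
  have hfin2 := hu.finite_level (show 0 < 2 * k by positivity)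
  rw [Set.ncard_eq_toFinset_card _ hfin, Set.ncard_eq_toFinset_card _ hfin2]
  set F := hfin.toFinset
  set F₂ := hfin2.toFinset
  have hF₂ : F₂ ⊆ F := fun x hx => by
    simp only [F₂, F, Set.Finite.mem_toFinset, Set.mem_ofPred_eq] at hx ⊢
    linarith
  rcases Nat.eq_zero_or_pos F.card with h0 | hpos
  · have : F₂.card = 0 := by
      have := Finset.card_le_card hF₂
      omega
    rw [this, Nat.cast_zero, mul_zero, zero_pow hd]
    positivity
  obtain ⟨L, hL1, hL2, hL3⟩ := exists_nat_pow_bounds hd hpos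
  set f : (Fin d → ℤ) → ℝ := fun x => min (max (u x - k) 0) k
  have hf0 : ∀ x, 0 ≤ f x := fun x => le_min (le_max_right _ _) hk.le
  have hfout : ∀ x ∉ F, f x = 0 := fun x hx => by
    simp only [F, Set.Finite.mem_toFinset, Set.mem_ofPred_eq, not_le] at hx
    simp only [f]
    rw [max_eq_right (by linarith), min_eq_left hk.le]
  have hfsupp : (Function.support f).Finite := F.finite_toSet.subset fun x hx => by
    by_contra h
    exact hx (hfout x h)
  have hf2 := memℓp_two_of_finite_support hfsupp
  have hf1 : Summable fun x => |f x| := summable_of_hasFiniteSupport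
    (hfsupp.subset fun x hx h => hx (by simp [h]))
  have hnash := tsum_sq_le_nash hf2 hf1 hL1
  have hE : latticeEnergy f ≤ α⁻¹ * k := hu.energy_clamp_le hα hT ha hk.le hk.le
  have e1 : ∑' x, |f x| = ∑ x ∈ F, |f x| :=
    tsum_eq_sum fun x hx => by rw [hfout x hx, abs_zero]
  have e2 : ∑' x, f x ^ 2 = ∑ x ∈ F, f x ^ 2 :=
    tsum_eq_sum fun x hx => by simp [hfout x hx]
  have hCS : (∑' x, |f x|) ^ 2 ≤ F.card * ∑' x, f x ^ 2 := by
    rw [e1, e2]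
    simpa only [sq_abs] using sq_sum_le_card_mul_sum_sq (s := F) (f := fun x => |f x|)
  have hX0 : 0 ≤ ∑' x, f x ^ 2 := tsum_nonneg fun _ => sq_nonneg _
  have hLd : (0 : ℝ) < (L : ℝ) ^ d := by
    have : (0 : ℝ) < L := by exact_mod_cast hL1
    positivity
  -- Cauchy-Schwarz on the support together with $L^d\ge2|F|$: Nash's inequality becomes a
  -- Faber-Krahn inequality.
  have hhalf : ((L : ℝ) ^ d)⁻¹ * (∑' x, |f x|) ^ 2 ≤ (1 / 2) * ∑' x, f x ^ 2 := by
    rw [inv_mul_eq_div, div_le_iff₀ hLd]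
    have h1 : (2 * F.card : ℝ) ≤ (L : ℝ) ^ d := by exact_mod_cast hL2
    nlinarith
  have hlow : k ^ 2 * F₂.card ≤ ∑' x, f x ^ 2 := by
    rw [e2]
    calc k ^ 2 * (F₂.card : ℝ) = ∑ x ∈ F₂, f x ^ 2 := by
          rw [Finset.sum_congr rfl fun x hx => ?_, Finset.sum_const, nsmul_eq_mul, mul_comm]
          simp only [F₂, Set.Finite.mem_toFinset, Set.mem_ofPred_eq] at hx
          simp only [f]
          rw [max_eq_left (by linarith), min_eq_right (by linarith)]
      _ ≤ _ := Finset.sum_le_sum_of_subset_of_nonneg hF₂ fun _ _ _ => sq_nonneg _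
  have h1 : k * F₂.card ≤ 2 ^ (d + 1) * α⁻¹ * (L : ℝ) ^ 2 := by
    have h2 : 2 ^ d * (L : ℝ) ^ 2 * latticeEnergy f ≤ 2 ^ d * (L : ℝ) ^ 2 * (α⁻¹ * k) := by gcongr
    have h3 : k * (k * F₂.card) ≤ k * (2 ^ (d + 1) * α⁻¹ * (L : ℝ) ^ 2) := by
      rw [pow_succ]
      linarith
    exact le_of_mul_le_mul_left h3 hk
  calc (k * (F₂.card : ℝ)) ^ d ≤ (2 ^ (d + 1) * α⁻¹ * (L : ℝ) ^ 2) ^ d := by gcongr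
    _ = (2 ^ (d + 1) * α⁻¹) ^ d * ((L : ℝ) ^ d) ^ 2 := by
        rw [mul_pow, ← pow_mul, ← pow_mul, mul_comm 2 d]
    _ ≤ (2 ^ (d + 1) * α⁻¹) ^ d * (2 ^ (d + 1) * F.card) ^ 2 := by
        gcongr
        exact_mod_cast hL3
    _ = _ := by ring

/-- The weak `L^{d/(d-2)}` bound for the Green's function in dimension `d = m + 2 > 2`. -/
theorem exists_ncard_level_pow_le {m : ℕ} (hm : 1 ≤ m) (hdm : d = m + 2) (hα : 0 < α) :
    ∃ M : ℝ, 1 ≤ M ∧ ∀ (β : ℝ) (a : (Fin d → ℤ) → (Fin d → ℤ) → ℝ), IsConductivity α β a →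
      ∀ (T : ℝ), 0 < T → ∀ (y : Fin d → ℤ) (u : (Fin d → ℤ) → ℝ), IsGreenFunction T a y u →
      ∀ k : ℝ, 0 < k → ({x | k ≤ u x}.ncard : ℝ) ^ m * k ^ d ≤ M := by
  set C : ℝ := (2 ^ (d + 1) * α⁻¹) ^ d * (2 ^ (d + 1)) ^ 2
  set C' : ℝ := 2 ^ (d * d) * C ^ m
  refine ⟨max 1 C', le_max_left _ _, fun β a ha T hT y u hu => ?_⟩
  set M := max 1 C'
  have hM1 : 1 ≤ M := le_max_left _ _
  have hd : d ≠ 0 := by omega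
  -- With $\Phi(k)=N(k)^m k^d$ the level set comparison reads $\Phi(2k)^d\le C'\Phi(k)^2$. Since
  -- $M\ge\max(1,C')$ and $d\ge3$, the bound $\Phi\le M$ passes from $k$ to $2k$.
  have hstep : ∀ k : ℝ, 0 < k → ({x | k ≤ u x}.ncard : ℝ) ^ m * k ^ d ≤ M →
      ({x | 2 * k ≤ u x}.ncard : ℝ) ^ m * (2 * k) ^ d ≤ M := by
    intro k hk h
    have h1 := hu.ncard_level_two_mul_le hd hα hT ha hk
    set N₁ : ℝ := ({x | k ≤ u x}.ncard : ℝ)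
    set N₂ : ℝ := ({x | 2 * k ≤ u x}.ncard : ℝ)
    have hN₁ : 0 ≤ N₁ := Nat.cast_nonneg _
    have hN₂ : 0 ≤ N₂ := Nat.cast_nonneg _
    refine le_of_pow_le_pow_left₀ hd (by positivity) ?_
    have e0 : k ^ (d * d) = k ^ (d * m) * k ^ (2 * d) := by
      rw [← pow_add]
      congr 1
      rw [hdm]
      ring
    calc (N₂ ^ m * (2 * k) ^ d) ^ d
        = 2 ^ (d * d) * k ^ (2 * d) * ((k * N₂) ^ d) ^ m := by
          rw [mul_pow, mul_pow, mul_pow, mul_pow, mul_pow, ← pow_mul, ← pow_mul, ← pow_mul,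
            ← pow_mul, ← pow_mul, e0, mul_comm m d]
          ring
      _ ≤ 2 ^ (d * d) * k ^ (2 * d) * (C * N₁ ^ 2) ^ m := by gcongr
      _ = C' * (N₁ ^ m * k ^ d) ^ 2 := by
          simp only [C']
          rw [mul_pow, mul_pow, ← pow_mul, ← pow_mul, ← pow_mul, mul_comm 2 m, mul_comm 2 d]
          ring
      _ ≤ M * M ^ 2 := by
          gcongr
          exact le_max_right _ _
      _ = M ^ 3 := by ring
      _ ≤ M ^ d := pow_le_pow_right₀ hM1 (by omega)
  have hiter : ∀ (j : ℕ) (k : ℝ), 0 < k → ({x | k ≤ u x}.ncard : ℝ) ^ m * k ^ d ≤ M →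
      ({x | 2 ^ j * k ≤ u x}.ncard : ℝ) ^ m * (2 ^ j * k) ^ d ≤ M := by
    intro j k hk h
    induction j with
    | zero => simpa using h
    | succ j ih =>
      have := hstep (2 ^ j * k) (by positivity) ih
      rwa [← mul_assoc, ← pow_succ'] at this
  intro k hk
  -- The propagation starts at a tiny level $\kappa=k/2^j$, where Chebyshev gives $\Phi(\kappa)\le
  -- T^m\kappa^2\le1$. Only $j$ depends on $T$, so the final bound does not.
  obtain ⟨j, hj⟩ := pow_unbounded_of_one_lt (T ^ m * k ^ 2) (one_lt_two (α := ℝ))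
  have h2j : (1 : ℝ) ≤ 2 ^ j := one_le_pow₀ (by norm_num)
  set κ := k / 2 ^ j
  have hκ : 0 < κ := by positivity
  have hκd : κ ^ d = κ ^ m * κ ^ 2 := by rw [hdm, pow_add]
  have hstart : ({x | κ ≤ u x}.ncard : ℝ) ^ m * κ ^ d ≤ M := by
    refine le_trans ?_ hM1
    calc ({x | κ ≤ u x}.ncard : ℝ) ^ m * κ ^ d
        = (κ * ({x | κ ≤ u x}.ncard : ℝ)) ^ m * κ ^ 2 := by
          rw [hκd, mul_pow]
          ring
      _ ≤ T ^ m * κ ^ 2 := by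
          gcongr
          exact hu.mul_ncard_level_le hα hT ha hκ
      _ = T ^ m * k ^ 2 / (2 ^ j) ^ 2 := by
          simp only [κ]
          rw [div_pow]
          ring
      _ ≤ 1 := by
          rw [div_le_one (by positivity)]
          nlinarith
  have h := hiter j κ hκ hstart
  have e : 2 ^ j * κ = k := by
    simp only [κ]
    field_simp
  rwa [e] at h

/-- In dimension `d > 2`, the Green's function has `L¹` norm `O(R²)` on sets of size `O(R^d)`. -/
theorem exists_sum_le_sq (hd : 2 < d) (hα : 0 < α) :
    ∃ C : ℝ, 0 < C ∧ ∀ (β : ℝ) (a : (Fin d → ℤ) → (Fin d → ℤ) → ℝ), IsConductivity α β a →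
      ∀ (T : ℝ), 0 < T → ∀ (y : Fin d → ℤ) (u : (Fin d → ℤ) → ℝ), IsGreenFunction T a y u →
      ∀ (R : ℝ), 0 < R → ∀ (A : ℝ) (F : Finset (Fin d → ℤ)), (F.card : ℝ) ≤ A * R ^ d →
        ∑ x ∈ F, u x ≤ (A + C) * R ^ 2 := by
  obtain ⟨m, hm, hdm⟩ : ∃ m, 1 ≤ m ∧ d = m + 2 := ⟨d - 2, by omega, by omega⟩
  obtain ⟨M, hM, h⟩ := exists_ncard_level_pow_le hm hdm hα
  have hm0 : m ≠ 0 := by omega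
  -- $\theta=2^{-d/(d-2)}$ is the factor by which the weak-type bound shrinks when the level
  -- doubles; $2\theta<1$ makes the dyadic sum geometric.
  set θ : ℝ := ((2 ^ d)⁻¹ : ℝ) ^ (m : ℝ)⁻¹
  have hθ0 : 0 < θ := by positivity
  have hθm : θ ^ m = (2 ^ d)⁻¹ := Real.rpow_inv_natCast_pow (by positivity) hm0
  have hθ1 : 2 * θ < 1 := by
    rw [← pow_lt_one_iff_of_nonneg (by positivity) hm0, mul_pow, hθm, hdm, pow_add]
    rw [mul_inv, ← mul_assoc, mul_inv_cancel₀ (by positivity)]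
    norm_num
  have hgeo : 0 < 1 - 2 * θ := by linarith
  refine ⟨2 * M * (1 - 2 * θ)⁻¹, by positivity, fun β a ha T hT y u hu R hR A F hF => ?_⟩
  have hu0 := hu.nonneg hα hT ha
  -- The natural height $R^{2-d}$: below it the cardinality of $F$ is used, above it the weak-type
  -- bound.
  set κ : ℝ := (R ^ m)⁻¹
  have hκ : 0 < κ := by positivity
  have hκR : κ * R ^ d = R ^ 2 := by
    simp only [κ]
    rw [hdm, pow_add]
    field_simp
  have hN : ∀ j : ℕ, ((F.filter fun x => 2 ^ j * κ ≤ u x).card : ℝ) ≤ M * R ^ d * θ ^ j := by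
    intro j
    have hk : 0 < 2 ^ j * κ := by positivity
    have h1 := h β a ha T hT y u hu (2 ^ j * κ) hk
    have h2 : ((F.filter fun x => 2 ^ j * κ ≤ u x).card : ℝ)
        ≤ ({x | 2 ^ j * κ ≤ u x}.ncard : ℝ) := by
      rw [← Set.ncard_coe_finset]
      refine Nat.cast_le.2 (Set.ncard_le_ncard (fun x hx => ?_) (hu.finite_level hk))
      exact (Finset.mem_filter.1 hx).2
    refine h2.trans (le_of_pow_le_pow_left₀ hm0 (by positivity) ?_)
    rw [← le_div_iff₀ (by positivity)] at h1
    refine h1.trans ?_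
    calc M / (2 ^ j * κ) ^ d = M * (R ^ d) ^ m * (θ ^ j) ^ m := by
          rw [pow_right_comm θ, hθm]
          simp only [κ]
          rw [mul_pow, inv_pow, inv_pow, pow_right_comm R, pow_right_comm 2]
          field_simp
      _ ≤ M ^ m * (R ^ d) ^ m * (θ ^ j) ^ m := by
          gcongr
          exact le_self_pow₀ hM hm0
      _ = _ := by rw [mul_pow, mul_pow]
  obtain ⟨J, hJ⟩ := exists_sum_rpow_le_dyadic F hu0 hκ zero_le_one
  simp only [Real.rpow_one] at hJ
  calc ∑ x ∈ F, u x ≤ _ := hJ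
    _ ≤ κ * (A * R ^ d) + ∑ j ∈ Finset.range J, 2 ^ (j + 1) * κ * (M * R ^ d * θ ^ j) := by
        gcongr with j hj
        exact hN j
    _ = A * (κ * R ^ d) + 2 * M * (κ * R ^ d) * ∑ j ∈ Finset.range J, (2 * θ) ^ j := by
        rw [Finset.mul_sum]
        congr 1
        · ring
        · refine Finset.sum_congr rfl fun j _ => ?_
          rw [mul_pow, pow_succ]
          ring
    _ ≤ A * (κ * R ^ d) + 2 * M * (κ * R ^ d) * (1 - 2 * θ)⁻¹ := by
        gcongr
        rw [← tsum_geometric_of_lt_one (by positivity) hθ1]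
        exact (summable_geometric_of_lt_one (by positivity) hθ1).sum_le_tsum _
          fun _ _ => by positivity
    _ = _ := by
        rw [hκR]
        ring

/-- `L^q` estimate of the Green's function on annuli, `d > 2`. -/
theorem exists_sum_latticeAnnulus_rpow_le_of_two_lt (hd : 2 < d) (hα : 0 < α) (hαβ : α ≤ β)
    {q : ℝ} (hq : 1 ≤ q) :
    ∃ C : ℝ, 0 < C ∧ ∀ (a : (Fin d → ℤ) → (Fin d → ℤ) → ℝ), IsConductivity α β a →
      ∀ (T : ℝ), 0 < T → ∀ (y : Fin d → ℤ) (u : (Fin d → ℤ) → ℝ), IsGreenFunction T a y u →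
      ∀ R : ℝ, 1 ≤ R → ∑ x ∈ latticeAnnulus y R, u x ^ q
          ≤ C * (R ^ (d : ℝ) * (R ^ (2 - d : ℝ)) ^ q) := by
  obtain ⟨C₁, hC₁, hA⟩ := exists_sum_latticeAnnulus_rpow_le_of_sum_le d hα hαβ hq
  obtain ⟨C₂, hC₂, hB⟩ := exists_sum_le_sq hd hα
  refine ⟨C₁ * (9 ^ d + C₂) ^ q, by positivity, fun a ha T hT y u hu R hR => ?_⟩
  have hR0 : 0 < R := by linarith
  refine hA a ha T hT y u hu.isSubsolution (hu.nonneg hα hT ha) R hR0 _ (by positivity)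
    (hB β a ha T hT y u hu R hR0 (9 ^ d) _ ?_)
  calc _ ≤ ((latticeBall y (4 * R)).card : ℝ) := by
        exact_mod_cast Finset.card_le_card (Finset.filter_subset _ _)
    _ ≤ (2 * (4 * R) + 1) ^ d := card_latticeBall_le y (by positivity)
    _ ≤ (9 * R) ^ d := by
        gcongr
        linarith
    _ = _ := mul_pow _ _ _

end WeakType

/-! ### Poincaré-Sobolev and Faber-Krahn inequalities on a planar square; medians and moments. -/

section Square

theorem sum_range_abs_sub_le {n i i' : ℕ} (f : ℕ → ℝ) (hi : i ≤ n) (hi' : i' ≤ n) :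
    |f i - f i'| ≤ ∑ l ∈ Finset.range n, |f (l + 1) - f l| := by
  wlog h : i' ≤ i generalizing i i'
  · rw [abs_sub_comm]
    exact this hi' hi (le_of_not_ge h)
  rw [← Finset.sum_Ico_sub f h]
  refine (Finset.abs_sum_le_sum_abs _ _).trans ?_
  refine Finset.sum_le_sum_of_subset_of_nonneg (fun l hl => ?_) fun _ _ _ => abs_nonneg _
  rw [Finset.mem_Ico] at hl
  rw [Finset.mem_range]
  omega

/-- The `L¹`-Poincaré-Sobolev inequality on a discrete square. -/
theorem sum_sq_sub_le_square (n : ℕ) (f : ℕ → ℕ → ℝ) :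
    ∑ i ∈ Finset.range (n + 1), ∑ j ∈ Finset.range (n + 1), ∑ i' ∈ Finset.range (n + 1),
      ∑ j' ∈ Finset.range (n + 1), (f i j - f i' j') ^ 2
      ≤ ((n : ℝ) + 1) ^ 2 *
        (∑ j ∈ Finset.range (n + 1), ∑ i ∈ Finset.range n, |f (i + 1) j - f i j|
          + ∑ i ∈ Finset.range (n + 1), ∑ j ∈ Finset.range n, |f i (j + 1) - f i j|) ^ 2 := by
  set V : ℕ → ℝ := fun j => ∑ i ∈ Finset.range n, |f (i + 1) j - f i j|
  set W : ℕ → ℝ := fun i => ∑ j ∈ Finset.range n, |f i (j + 1) - f i j|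
  have hmem : ∀ {i : ℕ}, i ∈ Finset.range (n + 1) → i ≤ n := fun h =>
    Nat.lt_succ_iff.1 (Finset.mem_range.1 h)
  -- The two L-shaped paths joining the points bound $|f(i,j)-f(i',j')|$ by expressions in disjoint
  -- variables, $(j,i')$ and $(i,j')$, so the sum of their product factorizes.
  have hpt : ∀ i ∈ Finset.range (n + 1), ∀ j ∈ Finset.range (n + 1), ∀ i' ∈ Finset.range (n + 1),
      ∀ j' ∈ Finset.range (n + 1), (f i j - f i' j') ^ 2 ≤ (V j + W i') * (W i + V j') := by
    intro i hi j hj i' hi' j' hj'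
    have h1 : |f i j - f i' j'| ≤ V j + W i' := (abs_sub_le _ (f i' j) _).trans
      (add_le_add (sum_range_abs_sub_le (fun l => f l j) (hmem hi) (hmem hi'))
        (sum_range_abs_sub_le (f i') (hmem hj) (hmem hj')))
    have h2 : |f i j - f i' j'| ≤ W i + V j' := (abs_sub_le _ (f i j') _).trans
      (add_le_add (sum_range_abs_sub_le (f i) (hmem hj) (hmem hj'))
        (sum_range_abs_sub_le (fun l => f l j') (hmem hi) (hmem hi')))
    rw [← sq_abs, pow_two]
    exact mul_le_mul h1 h2 (abs_nonneg _) ((abs_nonneg _).trans h1)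
  refine (Finset.sum_le_sum fun i hi => Finset.sum_le_sum fun j hj => Finset.sum_le_sum
    fun i' hi' => Finset.sum_le_sum fun j' hj' => hpt i hi j hj i' hi' j' hj').trans (le_of_eq ?_)
  simp only [add_mul, mul_add, Finset.sum_add_distrib, ← Finset.mul_sum, ← Finset.sum_mul,
    Finset.sum_const, Finset.card_range, nsmul_eq_mul]
  push_cast
  ring

/-- Only edges touching the support of $f$ contribute. By injectivity of the endpoint maps there are
at most twice as many as points of the support, and Cauchy-Schwarz is applied on these edges. -/
theorem sq_sum_abs_sub_le {ι κ : Type*} [DecidableEq κ] (E : Finset ι) (Q : Finset κ)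
    (s t : ι → κ) (hs : Set.InjOn s E) (ht : Set.InjOn t E) (hsQ : ∀ e ∈ E, s e ∈ Q)
    (htQ : ∀ e ∈ E, t e ∈ Q) (f : κ → ℝ) :
    (∑ e ∈ E, |f (t e) - f (s e)|) ^ 2
      ≤ 2 * ((Q.filter fun p => f p ≠ 0).card : ℝ) * ∑ e ∈ E, (f (t e) - f (s e)) ^ 2 := by
  classical
  set E' := E.filter fun e => f (s e) ≠ 0 ∨ f (t e) ≠ 0
  have h1 : ∑ e ∈ E, |f (t e) - f (s e)| = ∑ e ∈ E', |f (t e) - f (s e)| := by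
    refine (Finset.sum_filter_of_ne fun e _ h => ?_).symm
    by_contra h2
    simp only [not_or, not_not] at h2
    simp [h2.1, h2.2] at h
  have hcard : E'.card ≤ 2 * (Q.filter fun p => f p ≠ 0).card := by
    have h2 : E' = (E.filter fun e => f (s e) ≠ 0) ∪ (E.filter fun e => f (t e) ≠ 0) :=
      Finset.filter_or _ _ _
    have h3 : (E.filter fun e => f (s e) ≠ 0).card ≤ (Q.filter fun p => f p ≠ 0).card :=
      Finset.card_le_card_of_injOn s (fun e he => by
        simp only [Finset.coe_filter, Set.mem_ofPred_eq] at he ⊢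
        exact ⟨hsQ e he.1, he.2⟩) (hs.mono (Finset.coe_subset.2 (Finset.filter_subset _ _)))
    have h4 : (E.filter fun e => f (t e) ≠ 0).card ≤ (Q.filter fun p => f p ≠ 0).card :=
      Finset.card_le_card_of_injOn t (fun e he => by
        simp only [Finset.coe_filter, Set.mem_ofPred_eq] at he ⊢
        exact ⟨htQ e he.1, he.2⟩) (ht.mono (Finset.coe_subset.2 (Finset.filter_subset _ _)))
    rw [h2]
    have := Finset.card_union_le (E.filter fun e => f (s e) ≠ 0) (E.filter fun e => f (t e) ≠ 0)
    omega
  rw [h1]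
  calc (∑ e ∈ E', |f (t e) - f (s e)|) ^ 2
      ≤ E'.card * ∑ e ∈ E', |f (t e) - f (s e)| ^ 2 := sq_sum_le_card_mul_sum_sq
    _ ≤ 2 * ((Q.filter fun p => f p ≠ 0).card : ℝ) * ∑ e ∈ E, (f (t e) - f (s e)) ^ 2 := by
        simp only [sq_abs]
        refine mul_le_mul (by exact_mod_cast hcard) ?_ (Finset.sum_nonneg fun _ _ => sq_nonneg _)
          (by positivity)
        exact Finset.sum_le_sum_of_subset_of_nonneg (Finset.filter_subset _ _)
          fun _ _ _ => sq_nonneg _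

/-- The `(n+1) × (n+1)` square. -/
def gridSquare (n : ℕ) : Finset (ℕ × ℕ) := Finset.range (n + 1) ×ˢ Finset.range (n + 1)

theorem card_gridSquare (n : ℕ) : (gridSquare n).card = (n + 1) ^ 2 := by
  simp [gridSquare, pow_two]

/-- The Dirichlet energy on the `(n+1) × (n+1)` square. -/
def gridEnergy (n : ℕ) (f : ℕ × ℕ → ℝ) : ℝ :=
  ∑ e ∈ Finset.range n ×ˢ Finset.range (n + 1), (f (e.1 + 1, e.2) - f e) ^ 2
    + ∑ e ∈ Finset.range (n + 1) ×ˢ Finset.range n, (f (e.1, e.2 + 1) - f e) ^ 2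

/-- A Faber-Krahn inequality on a square, for functions vanishing on half of it. -/
theorem sum_sq_le_gridEnergy (n : ℕ) (f : ℕ × ℕ → ℝ) {Z : Finset (ℕ × ℕ)}
    (hZ : Z ⊆ gridSquare n) (hZc : (n + 1) ^ 2 ≤ 2 * Z.card) (hf : ∀ p ∈ Z, f p = 0) :
    ∑ p ∈ gridSquare n, f p ^ 2
      ≤ 8 * (((gridSquare n).filter fun p => f p ≠ 0).card : ℝ) * gridEnergy n f := by
  have hP := sum_sq_sub_le_square n fun i j => f (i, j)
  set K : ℝ := (((gridSquare n).filter fun p => f p ≠ 0).card : ℝ)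
  set H := ∑ e ∈ Finset.range n ×ˢ Finset.range (n + 1), |f (e.1 + 1, e.2) - f e| with hH
  set G := ∑ e ∈ Finset.range (n + 1) ×ˢ Finset.range n, |f (e.1, e.2 + 1) - f e| with hG
  have eH : ∑ j ∈ Finset.range (n + 1), ∑ i ∈ Finset.range n, |f (i + 1, j) - f (i, j)| = H := by
    rw [hH, Finset.sum_product_right]
  have eG : ∑ i ∈ Finset.range (n + 1), ∑ j ∈ Finset.range n, |f (i, j + 1) - f (i, j)| = G := by
    rw [hG, Finset.sum_product]
  have eL : ∑ i ∈ Finset.range (n + 1), ∑ j ∈ Finset.range (n + 1), ∑ i' ∈ Finset.range (n + 1),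
      ∑ j' ∈ Finset.range (n + 1), (f (i, j) - f (i', j')) ^ 2
      = ∑ p ∈ gridSquare n, ∑ p' ∈ gridSquare n, (f p - f p') ^ 2 := by
    simp only [gridSquare, Finset.sum_product]
  rw [eH, eG, eL] at hP
  have hH2 : H ^ 2 ≤ 2 * K * ∑ e ∈ Finset.range n ×ˢ Finset.range (n + 1),
      (f (e.1 + 1, e.2) - f e) ^ 2 := by
    refine sq_sum_abs_sub_le _ (gridSquare n) (fun e => e) (fun e => (e.1 + 1, e.2))
      (fun _ _ _ _ h => h) (fun e _ e' _ h => ?_) (fun e he => ?_) (fun e he => ?_) f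
    · simp only [Prod.mk.injEq, add_left_inj] at h
      exact Prod.ext h.1 h.2
    all_goals
      simp only [gridSquare, Finset.mem_product, Finset.mem_range] at he ⊢
      omega
  have hG2 : G ^ 2 ≤ 2 * K * ∑ e ∈ Finset.range (n + 1) ×ˢ Finset.range n,
      (f (e.1, e.2 + 1) - f e) ^ 2 := by
    refine sq_sum_abs_sub_le _ (gridSquare n) (fun e => e) (fun e => (e.1, e.2 + 1))
      (fun _ _ _ _ h => h) (fun e _ e' _ h => ?_) (fun e he => ?_) (fun e he => ?_) f
    · simp only [Prod.mk.injEq, add_left_inj] at h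
      exact Prod.ext h.1 h.2
    all_goals
      simp only [gridSquare, Finset.mem_product, Finset.mem_range] at he ⊢
      omega
  -- Restricting the second point to the zero set turns the difference into $f(p)$ itself.
  have hlow : Z.card * ∑ p ∈ gridSquare n, f p ^ 2
      ≤ ∑ p ∈ gridSquare n, ∑ p' ∈ gridSquare n, (f p - f p') ^ 2 := by
    rw [Finset.mul_sum]
    refine Finset.sum_le_sum fun p _ => ?_
    calc (Z.card : ℝ) * f p ^ 2 = ∑ p' ∈ Z, (f p - f p') ^ 2 := by
          rw [Finset.sum_congr rfl fun p' hp' => by rw [hf p' hp', sub_zero], Finset.sum_const,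
            nsmul_eq_mul]
      _ ≤ _ := Finset.sum_le_sum_of_subset_of_nonneg hZ fun _ _ _ => sq_nonneg _
  have hZR : ((n : ℝ) + 1) ^ 2 ≤ 2 * Z.card := by exact_mod_cast hZc
  have hX : 0 ≤ ∑ p ∈ gridSquare n, f p ^ 2 := Finset.sum_nonneg fun _ _ => sq_nonneg _
  have hn : (0 : ℝ) < ((n : ℝ) + 1) ^ 2 := by positivity
  have h1 : ((n : ℝ) + 1) ^ 2 * ∑ p ∈ gridSquare n, f p ^ 2
      ≤ ((n : ℝ) + 1) ^ 2 * (2 * (H + G) ^ 2) := by nlinarith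
  have h2 := le_of_mul_le_mul_left h1 hn
  have h3 : (H + G) ^ 2 ≤ 2 * (H ^ 2 + G ^ 2) := add_sq_le
  rw [gridEnergy]
  linarith

/-- The median is the least value with at least half of the points at or below it. If fewer than
half lay at or above it, the largest value strictly below would be a smaller candidate. -/
theorem exists_median {ι : Type*} (Q : Finset ι) (hQ : Q.Nonempty) (U : ι → ℝ) :
    ∃ p ∈ Q, Q.card ≤ 2 * (Q.filter fun x => U x ≤ U p).card ∧
      Q.card ≤ 2 * (Q.filter fun x => U p ≤ U x).card := by
  classical
  set P := Q.filter fun p => Q.card ≤ 2 * (Q.filter fun x => U x ≤ U p).card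
  have hP : P.Nonempty := by
    obtain ⟨p, hp, hmax⟩ := Finset.exists_max_image Q U hQ
    refine ⟨p, Finset.mem_filter.2 ⟨hp, ?_⟩⟩
    rw [Finset.filter_true_of_mem hmax]
    omega
  obtain ⟨p, hp, hmin⟩ := Finset.exists_min_image P U hP
  rw [Finset.mem_filter] at hp
  refine ⟨p, hp.1, hp.2, ?_⟩
  by_contra hlt
  have hsplit : (Q.filter fun x => U p ≤ U x).card + (Q.filter fun x => ¬ U p ≤ U x).card
      = Q.card := Finset.card_filter_add_card_filter_not _
  have hne : (Q.filter fun x => ¬ U p ≤ U x).Nonempty := by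
    rw [← Finset.card_pos]
    omega
  obtain ⟨z, hz, hmax⟩ := Finset.exists_max_image _ U hne
  rw [Finset.mem_filter, not_le] at hz
  have hzP : z ∈ P := by
    refine Finset.mem_filter.2 ⟨hz.1, ?_⟩
    have hsub : (Q.filter fun x => ¬ U p ≤ U x) ⊆ Q.filter fun x => U x ≤ U z := fun x hx =>
      Finset.mem_filter.2 ⟨(Finset.mem_filter.1 hx).1, hmax x hx⟩
    have := Finset.card_le_card hsub
    omega
  linarith [hmin z hzP]

/-- Each use of the recursion at level $2^j$ gains a full factor $2^{-j}$, so every power of decay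
is reached after finitely many uses, with $D$ independent of $N$ and $A$. -/
theorem exists_level_decay {C : ℝ} (hC : 0 ≤ C) (m : ℕ) :
    ∃ D : ℝ, 0 < D ∧ ∀ (A : ℝ) (N : ℝ → ℝ), 0 ≤ A → (∀ k, N k ≤ A) →
      (∀ k, 0 < k → k * N (2 * k) ≤ C * N k) → ∀ j : ℕ, N (2 ^ j) ≤ D * A / (2 ^ j) ^ m := by
  induction m with
  | zero => exact ⟨1, one_pos, fun A N _ hA _ j => by simpa using hA _⟩
  | succ m ih =>
    obtain ⟨D, hD, ih⟩ := ih
    refine ⟨max 1 (C * D * 2 ^ (m + 1)), by positivity, fun A N hA0 hA hN j => ?_⟩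
    have h0 := ih A N hA0 hA hN
    rcases j with _ | j
    · rw [pow_zero, one_pow, div_one]
      exact (hA 1).trans (le_mul_of_one_le_left hA0 (le_max_left _ _))
    · have h2 : (0 : ℝ) < 2 ^ j := by positivity
      have h1 := hN (2 ^ j) h2
      rw [← pow_succ'] at h1
      calc N (2 ^ (j + 1)) ≤ C * N (2 ^ j) / 2 ^ j := by
            rw [le_div_iff₀ h2]
            linarith
        _ ≤ C * (D * A / (2 ^ j) ^ m) / 2 ^ j := by
            gcongr
            exact h0 j
        _ = C * D * 2 ^ (m + 1) * A / (2 ^ (j + 1)) ^ (m + 1) := by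
            rw [pow_succ 2 j, mul_pow, pow_succ (2 ^ j) m]
            field_simp
        _ ≤ _ := by
            gcongr
            exact le_max_right _ _

/-- Moment bounds from the self-improving level set estimate. -/
theorem exists_sum_rpow_le_of_level {C : ℝ} (hC : 0 ≤ C) {q : ℝ} (hq : 0 ≤ q) :
    ∃ D : ℝ, 0 < D ∧ ∀ (ι : Type) (F : Finset ι) (f : ι → ℝ), (∀ x, 0 ≤ f x) →
      (∀ k, 0 < k → k * ((F.filter fun x => 2 * k ≤ f x).card : ℝ)
        ≤ C * ((F.filter fun x => k ≤ f x).card : ℝ)) →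
      ∑ x ∈ F, f x ^ q ≤ D * F.card := by
  -- One power of decay more than $q$ leaves a geometric series of ratio $1/2$.
  set m := ⌈q⌉₊ + 1
  have hm : q + 1 ≤ m := by
    simp only [m]
    push_cast
    linarith [Nat.le_ceil q]
  obtain ⟨D, hD, h⟩ := exists_level_decay hC m
  refine ⟨1 + 2 ^ q * D * 2, by positivity, fun ι F f hf hN => ?_⟩
  have h1 := h F.card (fun k => ((F.filter fun x => k ≤ f x).card : ℝ)) (Nat.cast_nonneg _)
    (fun k => by exact_mod_cast Finset.card_filter_le _ _) hN
  obtain ⟨J, hJ⟩ := exists_sum_rpow_le_dyadic F hf one_pos hq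
  simp only [mul_one, Real.one_rpow, one_mul] at hJ
  have hterm : ∀ j : ℕ, ((2 : ℝ) ^ (j + 1)) ^ q * ((F.filter fun x => 2 ^ j ≤ f x).card : ℝ)
      ≤ 2 ^ q * D * F.card * (1 / 2) ^ j := by
    intro j
    have h2 : (1 : ℝ) ≤ 2 ^ j := one_le_pow₀ (by norm_num)
    have h3 : ((2 : ℝ) ^ j) ^ q * 2 ^ j ≤ (2 ^ j) ^ m := by
      rw [← Real.rpow_natCast (2 ^ j) m, ← Real.rpow_add_one (by positivity)]
      exact Real.rpow_le_rpow_of_exponent_le h2 hm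
    calc ((2 : ℝ) ^ (j + 1)) ^ q * ((F.filter fun x => 2 ^ j ≤ f x).card : ℝ)
        ≤ ((2 : ℝ) ^ (j + 1)) ^ q * (D * F.card / (2 ^ j) ^ m) := by
          gcongr
          exact h1 j
      _ = 2 ^ q * D * F.card * ((2 ^ j) ^ q / (2 ^ j) ^ m) := by
          rw [pow_succ, Real.mul_rpow (by positivity) (by positivity)]
          ring
      _ ≤ 2 ^ q * D * F.card * (1 / 2) ^ j := by
          gcongr
          rw [one_div, inv_pow, ← one_div, div_le_div_iff₀ (by positivity) (by positivity)]
          linarith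
  calc ∑ x ∈ F, f x ^ q ≤ _ := hJ
    _ ≤ F.card + ∑ j ∈ Finset.range J, 2 ^ q * D * F.card * (1 / 2) ^ j := by
        exact add_le_add le_rfl (Finset.sum_le_sum fun j _ => hterm j)
    _ ≤ F.card + 2 ^ q * D * F.card * 2 := by
        have h2 := summable_geometric_two.sum_le_tsum (Finset.range J) fun _ _ => by positivity
        rw [tsum_geometric_two] at h2
        rw [← Finset.mul_sum]
        gcongr
    _ = _ := by ring

end Square

/-! ### Deviation of the planar Green's function from its median and from its average. -/

section Bmo

/-- The lattice point with coordinates `e - (n, n)` relative to `y`. -/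
def gridPoint (y : Fin 2 → ℤ) (n : ℕ) (e : ℕ × ℕ) : Fin 2 → ℤ :=
  y + ![(e.1 : ℤ) - n, (e.2 : ℤ) - n]

theorem gridPoint_injective (y : Fin 2 → ℤ) (n : ℕ) : Function.Injective (gridPoint y n) := by
  intro e e' h
  have h0 := congrFun h 0
  have h1 := congrFun h 1
  simp only [gridPoint, Pi.add_apply, Matrix.cons_val_zero, Matrix.cons_val_one] at h0 h1
  ext <;> omega

theorem gridPoint_apply_zero (y : Fin 2 → ℤ) (n : ℕ) (e : ℕ × ℕ) :
    gridPoint y n e 0 = y 0 + (e.1 - n) := rfl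

theorem gridPoint_apply_one (y : Fin 2 → ℤ) (n : ℕ) (e : ℕ × ℕ) :
    gridPoint y n e 1 = y 1 + (e.2 - n) := rfl

theorem gridPoint_succ_left (y : Fin 2 → ℤ) (n : ℕ) (e : ℕ × ℕ) :
    gridPoint y n (e.1 + 1, e.2) = gridPoint y n e + latticeBasis 0 := by
  refine funext (Fin.forall_fin_two.2 ⟨?_, ?_⟩)
  · rw [Pi.add_apply, gridPoint_apply_zero, gridPoint_apply_zero, latticeBasis, Pi.single_eq_same]
    push_cast
    ring
  · rw [Pi.add_apply, gridPoint_apply_one, gridPoint_apply_one, latticeBasis,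
      Pi.single_eq_of_ne one_ne_zero, add_zero]

theorem gridPoint_succ_right (y : Fin 2 → ℤ) (n : ℕ) (e : ℕ × ℕ) :
    gridPoint y n (e.1, e.2 + 1) = gridPoint y n e + latticeBasis 1 := by
  refine funext (Fin.forall_fin_two.2 ⟨?_, ?_⟩)
  · rw [Pi.add_apply, gridPoint_apply_zero, gridPoint_apply_zero, latticeBasis,
      Pi.single_eq_of_ne zero_ne_one, add_zero]
  · rw [Pi.add_apply, gridPoint_apply_one, gridPoint_apply_one, latticeBasis, Pi.single_eq_same]
    push_cast
    ring

theorem sum_comp_le_tsum {ι κ : Type*} {f : κ → ℝ} (hf : Summable f) (hf0 : ∀ x, 0 ≤ f x)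
    {p : ι → κ} (hp : Function.Injective p) (E : Finset ι) : ∑ e ∈ E, f (p e) ≤ ∑' x, f x := by
  have h := Finset.sum_map E ⟨p, hp⟩ f
  simp only [Function.Embedding.coeFn_mk] at h
  rw [← h]
  exact hf.sum_le_tsum _ fun _ _ => hf0 _

theorem gridEnergy_comp_gridPoint_le {f : (Fin 2 → ℤ) → ℝ} (hf : Memℓp f 2) (y : Fin 2 → ℤ)
    (m n : ℕ) : gridEnergy n (fun e => f (gridPoint y m e)) ≤ latticeEnergy f := by
  rw [latticeEnergy_eq_sum hf, Fin.sum_univ_two, gridEnergy]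
  simp only [gridPoint_succ_left, gridPoint_succ_right]
  exact add_le_add
    (sum_comp_le_tsum (lp_two_summable_sq (memℓp_grad hf 0)) (fun _ => sq_nonneg _)
      (gridPoint_injective y m) _)
    (sum_comp_le_tsum (lp_two_summable_sq (memℓp_grad hf 1)) (fun _ => sq_nonneg _)
      (gridPoint_injective y m) _)

theorem latticeBall_subset_image_gridPoint (y : Fin 2 → ℤ) {R : ℝ} (hR : 0 ≤ R) :
    latticeBall y R ⊆ (gridSquare (2 * ⌊R⌋₊)).image (gridPoint y ⌊R⌋₊) := by
  intro x hx
  have h : ∀ i, |x i - y i| ≤ (⌊R⌋₊ : ℤ) := fun i => by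
    have h1 : |((x i - y i : ℤ) : ℝ)| ≤ R :=
      (abs_le_latticeNorm (x - y) i).trans (mem_latticeBall.1 hx)
    rw [Int.natCast_floor_eq_floor hR, Int.le_floor]
    exact_mod_cast h1
  have h0 := abs_le.1 (h 0)
  have h1 := abs_le.1 (h 1)
  refine Finset.mem_image.2 ⟨((x 0 - y 0 + ⌊R⌋₊).toNat, (x 1 - y 1 + ⌊R⌋₊).toNat), ?_, ?_⟩
  · simp only [gridSquare, Finset.mem_product, Finset.mem_range]
    omega
  · refine funext (Fin.forall_fin_two.2 ⟨?_, ?_⟩)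
    · rw [gridPoint_apply_zero]
      omega
    · rw [gridPoint_apply_one]
      omega

section Median

variable {α β T : ℝ} {a : (Fin 2 → ℤ) → (Fin 2 → ℤ) → ℝ} {y : Fin 2 → ℤ} {u : (Fin 2 → ℤ) → ℝ}

theorem IsGreenFunction.gridEnergy_clamp_le (hu : IsGreenFunction T a y u) (hα : 0 < α)
    (hT : 0 < T) (ha : IsConductivity α β a) {lo k : ℝ} (hlo : 0 ≤ lo) (hk : 0 ≤ k)
    (z : Fin 2 → ℤ) (m n : ℕ) :
    gridEnergy n (fun e => min (max (u (gridPoint z m e) - lo) 0) k) ≤ α⁻¹ * k :=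
  (gridEnergy_comp_gridPoint_le (f := fun x => min (max (u x - lo) 0) k)
    (memℓp_two_of_abs_le hu.memℓp fun x => abs_comp_le (lipschitzWith_clamp lo k)
      (by simp [hlo, hk]) _) z m n).trans (hu.energy_clamp_le hα hT ha hlo hk)

/-- Serves the truncations above and below the median alike. The energy is linear in $k$ and $f^2$
quadratic, so one factor $k$ survives; this is the source of the decay. -/
theorem sq_mul_card_le_gridEnergy {n : ℕ} {f : ℕ × ℕ → ℝ} {k B : ℝ} (hk : 0 < k)
    {X Y Z : Finset (ℕ × ℕ)} (hZ : Z ⊆ gridSquare n) (hZc : (n + 1) ^ 2 ≤ 2 * Z.card)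
    (hf : ∀ p ∈ Z, f p = 0) (hX : X ⊆ gridSquare n) (hfX : ∀ p ∈ X, f p = k)
    (hY : ∀ p ∈ gridSquare n, f p ≠ 0 → p ∈ Y) (hE : gridEnergy n f ≤ B * k) :
    k * X.card ≤ 8 * B * Y.card := by
  have h := sum_sq_le_gridEnergy n f hZ hZc hf
  have h1 : k ^ 2 * X.card ≤ ∑ p ∈ gridSquare n, f p ^ 2 := by
    calc k ^ 2 * (X.card : ℝ) = ∑ p ∈ X, f p ^ 2 := by
          rw [Finset.sum_congr rfl fun p hp => by rw [hfX p hp], Finset.sum_const, nsmul_eq_mul,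
            mul_comm]
      _ ≤ _ := Finset.sum_le_sum_of_subset_of_nonneg hX fun _ _ _ => sq_nonneg _
  have h2 : (((gridSquare n).filter fun p => f p ≠ 0).card : ℝ) ≤ Y.card := by
    exact_mod_cast Finset.card_le_card fun p hp =>
      hY p (Finset.mem_filter.1 hp).1 (Finset.mem_filter.1 hp).2
  have hE0 : 0 ≤ gridEnergy n f :=
    add_nonneg (Finset.sum_nonneg fun _ _ => sq_nonneg _) (Finset.sum_nonneg fun _ _ => sq_nonneg _)
  have h3 : 8 * (((gridSquare n).filter fun p => f p ≠ 0).card : ℝ) * gridEnergy n f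
      ≤ 8 * Y.card * (B * k) := by gcongr
  have h4 : k * (k * X.card) ≤ k * (8 * B * Y.card) := by linarith
  exact le_of_mul_le_mul_left h4 hk

/-- The Green's function deviates from its median on a square by `O(1)`, in every `L^q`. -/
theorem exists_sum_abs_sub_median_le (hα : 0 < α) {q : ℝ} (hq : 0 ≤ q) :
    ∃ D : ℝ, 0 < D ∧ ∀ (β : ℝ) (a : (Fin 2 → ℤ) → (Fin 2 → ℤ) → ℝ), IsConductivity α β a →
      ∀ (T : ℝ), 0 < T → ∀ (y : Fin 2 → ℤ) (u : (Fin 2 → ℤ) → ℝ), IsGreenFunction T a y u →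
      ∀ R : ℝ, 1 ≤ R → ∃ c : ℝ, 0 ≤ c ∧ c * R ^ 2 ≤ 2 * T ∧
        ∑ x ∈ latticeBall y R, |u x - c| ^ q ≤ D * R ^ 2 := by
  obtain ⟨D, hD, h⟩ := exists_sum_rpow_le_of_level (C := 16 * α⁻¹) (by positivity) hq
  refine ⟨D * 9, by positivity, fun β a ha T hT y u hu R hR => ?_⟩
  have hu0 := hu.nonneg hα hT ha
  set m := ⌊R⌋₊
  set n := 2 * m with hn
  set Q := gridSquare n with hQ
  have hQc : Q.card = (n + 1) ^ 2 := card_gridSquare n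
  have hQne : Q.Nonempty := by
    rw [← Finset.card_pos, hQc]
    positivity
  set U : ℕ × ℕ → ℝ := fun e => u (gridPoint y m e) with hU
  have hU0 : ∀ e, 0 ≤ U e := fun e => hu0 _
  obtain ⟨p₀, -, hp1, hp2⟩ := exists_median Q hQne U
  set c := U p₀
  have hc : 0 ≤ c := hU0 _
  rw [hQc] at hp1 hp2
  have hmR : (m : ℝ) ≤ R := Nat.floor_le (by linarith)
  have hRm : R < m + 1 := Nat.lt_floor_add_one R
  have hnR : ((n : ℝ) + 1) = 2 * m + 1 := by
    rw [hn]
    push_cast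
    ring
  refine ⟨c, hc, ?_, ?_⟩
  -- On at least half of the square $u\ge c$, so the mass bound limits the median.
  · have h1 : ((Q.filter fun e => c ≤ U e).card : ℝ) * c ≤ T := by
      calc ((Q.filter fun e => c ≤ U e).card : ℝ) * c = ∑ e ∈ Q.filter fun e => c ≤ U e, c := by
            simp
        _ ≤ ∑ e ∈ Q.filter fun e => c ≤ U e, U e :=
            Finset.sum_le_sum fun e he => (Finset.mem_filter.1 he).2
        _ = ∑ x ∈ (Q.filter fun e => c ≤ U e).map ⟨gridPoint y m, gridPoint_injective y m⟩, u x := by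
            rw [Finset.sum_map]
            rfl
        _ ≤ T := hu.sum_le hα hT ha _
    have h2 : R ^ 2 ≤ 2 * ((Q.filter fun e => c ≤ U e).card : ℝ) := by
      calc R ^ 2 ≤ ((n : ℝ) + 1) ^ 2 := by
            gcongr
            rw [hnR]
            have : (0 : ℝ) ≤ m := Nat.cast_nonneg m
            linarith
        _ ≤ _ := by exact_mod_cast hp2
    nlinarith
  · have hlevel : ∀ k, 0 < k → k * ((Q.filter fun e => 2 * k ≤ |U e - c|).card : ℝ)
        ≤ 16 * α⁻¹ * ((Q.filter fun e => k ≤ |U e - c|).card : ℝ) := by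
      intro k hk
      set Y := Q.filter fun e => k ≤ |U e - c|
      have hup : k * ((Q.filter fun e => c + 2 * k ≤ U e).card : ℝ) ≤ 8 * α⁻¹ * Y.card := by
        refine sq_mul_card_le_gridEnergy (f := fun e => min (max (U e - (c + k)) 0) k) hk
          (Finset.filter_subset (fun e => U e ≤ c) Q) hp1 (fun p hp => ?_)
          (Finset.filter_subset _ _) (fun p hp => ?_) (fun p hp hne => ?_)
          (hu.gridEnergy_clamp_le hα hT ha (by positivity) hk.le y m n)
        · have := (Finset.mem_filter.1 hp).2
          rw [max_eq_right (by linarith), min_eq_left hk.le]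
        · have := (Finset.mem_filter.1 hp).2
          rw [max_eq_left (by linarith), min_eq_right (by linarith)]
        · refine Finset.mem_filter.2 ⟨hp, ?_⟩
          by_contra hlt
          rw [not_le, abs_lt] at hlt
          refine hne ?_
          rw [max_eq_right (by linarith), min_eq_left hk.le]
      have hdown : k * ((Q.filter fun e => U e ≤ c - 2 * k).card : ℝ) ≤ 8 * α⁻¹ * Y.card := by
        -- Positivity of $u$ empties the lower set when $c<2k$; otherwise the slice starts at a
        -- nonnegative height, as the energy bound requires.
        rcases lt_or_ge (c - 2 * k) 0 with hneg | hnn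
        · have : (Q.filter fun e => U e ≤ c - 2 * k) = ∅ :=
            Finset.filter_false_of_mem fun e _ => by linarith [hU0 e]
          rw [this, Finset.card_empty, Nat.cast_zero, mul_zero]
          positivity
        -- Reflecting the slice leaves its energy unchanged and makes it vanish where $u\ge c$.
        · have hE : gridEnergy n (fun e => k - min (max (U e - (c - 2 * k)) 0) k) ≤ α⁻¹ * k := by
            refine le_trans (le_of_eq ?_) (hu.gridEnergy_clamp_le hα hT ha hnn hk.le y m n)
            simp only [gridEnergy, hU]
            congr 1 <;> exact Finset.sum_congr rfl fun e _ => by ring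
          refine sq_mul_card_le_gridEnergy hk
            (Finset.filter_subset (fun e => c ≤ U e) Q) hp2 (fun p hp => ?_)
            (Finset.filter_subset _ _) (fun p hp => ?_) (fun p hp hne => ?_) hE
          · have := (Finset.mem_filter.1 hp).2
            rw [max_eq_left (by linarith), min_eq_right (by linarith), sub_self]
          · have := (Finset.mem_filter.1 hp).2
            rw [max_eq_right (by linarith), min_eq_left hk.le, sub_zero]
          · refine Finset.mem_filter.2 ⟨hp, ?_⟩
            by_contra hlt
            rw [not_le, abs_lt] at hlt
            refine hne ?_
            rw [max_eq_left (by linarith), min_eq_right (by linarith), sub_self]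
      have hsub : (Q.filter fun e => 2 * k ≤ |U e - c|)
          ⊆ (Q.filter fun e => c + 2 * k ≤ U e) ∪ (Q.filter fun e => U e ≤ c - 2 * k) := by
        intro e he
        rw [Finset.mem_filter, le_abs] at he
        rw [Finset.mem_union, Finset.mem_filter, Finset.mem_filter]
        rcases he with ⟨he, h1 | h1⟩
        · exact Or.inl ⟨he, by linarith⟩
        · exact Or.inr ⟨he, by linarith⟩
      have hcard : ((Q.filter fun e => 2 * k ≤ |U e - c|).card : ℝ)
          ≤ (Q.filter fun e => c + 2 * k ≤ U e).card + (Q.filter fun e => U e ≤ c - 2 * k).card := by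
        exact_mod_cast (Finset.card_le_card hsub).trans (Finset.card_union_le _ _)
      have := mul_le_mul_of_nonneg_left hcard hk.le
      linarith
    have h1 := h (ℕ × ℕ) Q (fun e => |U e - c|) (fun _ => abs_nonneg _) hlevel
    calc ∑ x ∈ latticeBall y R, |u x - c| ^ q
        ≤ ∑ x ∈ Q.image (gridPoint y m), |u x - c| ^ q :=
          Finset.sum_le_sum_of_subset_of_nonneg
            (latticeBall_subset_image_gridPoint y (by linarith)) fun _ _ _ => by positivity
      _ = ∑ e ∈ Q, |U e - c| ^ q := Finset.sum_image (gridPoint_injective y m).injOn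
      _ ≤ D * Q.card := h1
      _ = D * ((n : ℝ) + 1) ^ 2 := by
          rw [hQc]
          push_cast
          rfl
      _ ≤ D * (3 * R) ^ 2 := by
          gcongr
          rw [hnR]
          linarith
      _ = _ := by ring

end Median

/-- By Jensen, the distance from $c$ to the average is controlled by the mean $q$-th deviation from
$c$. -/
theorem sum_abs_sub_ballAverage_rpow_le {d : ℕ} (u : (Fin d → ℤ) → ℝ) (y : Fin d → ℤ) {R : ℝ}
    (hR : 0 ≤ R) {q : ℝ} (hq : 1 ≤ q) (c : ℝ) :
    ∑ x ∈ latticeBall y R, |u x - ballAverage u y R| ^ q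
      ≤ 2 ^ q * 2 * ∑ x ∈ latticeBall y R, |u x - c| ^ q := by
  set B := latticeBall y R
  have hB : 0 < (B.card : ℝ) := by
    have : y ∈ B := mem_latticeBall.2 (by rwa [sub_self, latticeNorm_zero])
    exact_mod_cast Finset.card_pos.2 ⟨y, this⟩
  set A := ballAverage u y R with hA
  have hq0 : 0 ≤ q := by linarith
  have hAc : |c - A| ≤ ∑ x ∈ B, (B.card : ℝ)⁻¹ * |u x - c| := by
    have e : A - c = ∑ x ∈ B, (B.card : ℝ)⁻¹ * (u x - c) := by
      rw [← Finset.mul_sum, Finset.sum_sub_distrib, Finset.sum_const, nsmul_eq_mul, hA, ballAverage,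
        mul_sub, inv_mul_cancel_left₀ hB.ne', inv_mul_eq_div]
    rw [abs_sub_comm, e]
    refine (Finset.abs_sum_le_sum_abs _ _).trans (le_of_eq (Finset.sum_congr rfl fun x _ => ?_))
    rw [abs_mul, abs_of_pos (inv_pos.2 hB)]
  have hJ : |c - A| ^ q ≤ ∑ x ∈ B, (B.card : ℝ)⁻¹ * |u x - c| ^ q :=
    (Real.rpow_le_rpow (abs_nonneg _) hAc hq0).trans
      (Real.rpow_arith_mean_le_arith_mean_rpow B _ _ (fun _ _ => by positivity)
        (by rw [Finset.sum_const, nsmul_eq_mul, mul_inv_cancel₀ hB.ne'])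
        (fun _ _ => abs_nonneg _) hq)
  rw [← Finset.mul_sum, inv_mul_eq_div, le_div_iff₀ hB] at hJ
  have hpt : ∀ x, |u x - A| ^ q ≤ 2 ^ q * (|u x - c| ^ q + |c - A| ^ q) := by
    intro x
    have h1 : |u x - A| ≤ 2 * max |u x - c| |c - A| := by
      have := abs_sub_le (u x) c A
      linarith [le_max_left |u x - c| |c - A|, le_max_right |u x - c| |c - A|]
    refine (Real.rpow_le_rpow (abs_nonneg _) h1 hq0).trans ?_
    rw [Real.mul_rpow zero_le_two (le_max_of_le_left (abs_nonneg _))]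
    refine mul_le_mul_of_nonneg_left ?_ (by positivity)
    have h2 : 0 ≤ |u x - c| ^ q := by positivity
    have h3 : 0 ≤ |c - A| ^ q := by positivity
    rcases max_choice |u x - c| |c - A| with h | h <;> rw [h] <;> linarith
  refine (Finset.sum_le_sum fun x _ => hpt x).trans ?_
  rw [← Finset.mul_sum, Finset.sum_add_distrib, Finset.sum_const, nsmul_eq_mul, mul_assoc]
  refine mul_le_mul_of_nonneg_left ?_ (by positivity)
  linarith

end Bmo

/-! ### Assembly of the four estimates. -/

theorem lemma2p8 (d : ℕ) (hd : 2 ≤ d) (α β : ℝ) (hα : 0 < α) (hαβ : α ≤ β) :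
    ∃ R₀ : ℝ, 1 ≤ R₀ ∧
      -- BMO-type estimate, `d = 2`
      (d = 2 → ∀ q : ℝ, 1 ≤ q → ∃ C : ℝ, 0 < C ∧
        ∀ a : (Fin d → ℤ) → (Fin d → ℤ) → ℝ, IsConductivity α β a →
        ∀ T : ℝ, 0 < T → ∀ y : Fin d → ℤ, ∀ R : ℝ, R₀ ≤ R →
          ∑ x ∈ latticeBall y R,
            |greenFunction T a x y - ballAverage (fun z => greenFunction T a z y) y R| ^ q
          ≤ C * R ^ 2) ∧
      -- `L^q` estimate on annuli, `d > 2`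
      (2 < d → ∀ q : ℝ, 1 ≤ q → ∃ C : ℝ, 0 < C ∧
        ∀ a : (Fin d → ℤ) → (Fin d → ℤ) → ℝ, IsConductivity α β a →
        ∀ T : ℝ, 0 < T → ∀ y : Fin d → ℤ, ∀ R : ℝ, R₀ ≤ R →
          ∑ x ∈ latticeAnnulus y R, greenFunction T a x y ^ q
          ≤ C * (R ^ (d : ℝ) * (R ^ (2 - d : ℝ)) ^ q)) ∧
      -- behaviour for `R ∼ √T`, `d = 2`
      (d = 2 → ∀ c₁ c₂ : ℝ, 0 < c₁ → c₁ ≤ c₂ → ∃ C : ℝ, 0 < C ∧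
        ∀ a : (Fin d → ℤ) → (Fin d → ℤ) → ℝ, IsConductivity α β a →
        ∀ T : ℝ, 0 < T → ∀ y : Fin d → ℤ, ∀ R : ℝ,
          c₁ * Real.sqrt T ≤ R → R ≤ c₂ * Real.sqrt T →
          (R ^ 2)⁻¹ * ∑ x ∈ latticeBall y R, greenFunction T a x y ^ 2 ≤ C) ∧
      -- decay at infinity
      (∀ q r : ℝ, 1 ≤ q → 0 ≤ r → ∃ R₁ : ℝ, 1 ≤ R₁ ∧ ∀ T₀ : ℝ, 0 < T₀ → ∃ C : ℝ, 0 < C ∧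
        ∀ a : (Fin d → ℤ) → (Fin d → ℤ) → ℝ, IsConductivity α β a →
        ∀ T : ℝ, 0 < T → ∀ y : Fin d → ℤ, ∀ R : ℝ, Real.sqrt T ≤ R →
          (T₀ ≤ T ∨ R₁ ≤ R) →
          ∑ x ∈ latticeAnnulus y R, greenFunction T a x y ^ q
          ≤ C * (R ^ (d : ℝ) * (R ^ (2 - d : ℝ)) ^ q * (Real.sqrt T / R) ^ r)) := by
  refine ⟨1, le_rfl, ?_, ?_, ?_, ?_⟩
  · rintro rfl q hq
    obtain ⟨D, hD, h⟩ := exists_sum_abs_sub_median_le hα (by linarith : 0 ≤ q)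
    refine ⟨2 ^ q * 2 * D, by positivity, fun a ha T hT y R hR => ?_⟩
    obtain ⟨c, -, -, hc⟩ :=
      h β a ha T hT y _ (isGreenFunction_greenFunction hα hT ha y) R hR
    refine (sum_abs_sub_ballAverage_rpow_le _ y (by linarith) hq c).trans ?_
    rw [mul_assoc _ D]
    gcongr
  · intro hd2 q hq
    obtain ⟨C, hC, h⟩ := exists_sum_latticeAnnulus_rpow_le_of_two_lt hd2 hα hαβ hq
    exact ⟨C, hC, fun a ha T hT y R hR =>
      h a ha T hT y _ (isGreenFunction_greenFunction hα hT ha y) R hR⟩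
  · rintro rfl c₁ c₂ hc₁ hc₁₂
    obtain ⟨D, hD, h⟩ := exists_sum_abs_sub_median_le hα (q := 2) zero_le_two
    refine ⟨2 * D + 72 / c₁ ^ 4 + 1 / c₁ ^ 4, by positivity, fun a ha T hT y R hR1 hR2 => ?_⟩
    have hG := isGreenFunction_greenFunction hα hT ha y
    set u : (Fin 2 → ℤ) → ℝ := fun x => greenFunction T a x y
    have hsT : 0 < √T := Real.sqrt_pos.2 hT
    have hR : 0 < R := (by positivity : 0 < c₁ * √T).trans_le hR1
    have hTR : c₁ ^ 2 * T ≤ R ^ 2 := by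
      calc c₁ ^ 2 * T = (c₁ * √T) ^ 2 := by rw [mul_pow, Real.sq_sqrt hT.le]
        _ ≤ R ^ 2 := by gcongr
    have hTR' : T ≤ R ^ 2 / c₁ ^ 2 := by
      rw [le_div_iff₀ (by positivity)]
      linarith
    rw [inv_mul_eq_div, div_le_iff₀ (by positivity)]
    -- The median estimate needs $R\ge1$. Below that the ball is the single point $y$, and $u(y)\le
    -- T\le R^2/c_1^2$ suffices.
    rcases lt_or_ge R 1 with hlt | hge
    · have hball : latticeBall y R ⊆ {y} := fun x hx => by
        rw [mem_latticeBall] at hx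
        rw [Finset.mem_singleton]
        by_contra hne
        linarith [one_le_latticeNorm (sub_ne_zero.2 hne)]
      have h1 : ∑ x ∈ latticeBall y R, u x ^ 2 ≤ T ^ 2 := by
        calc ∑ x ∈ latticeBall y R, u x ^ 2 ≤ ∑ x ∈ {y}, u x ^ 2 :=
              Finset.sum_le_sum_of_subset_of_nonneg hball fun _ _ _ => sq_nonneg _
          _ = u y ^ 2 := Finset.sum_singleton _ _
          _ ≤ T ^ 2 := by
              have h2 := hG.sum_le hα hT ha {y}
              rw [Finset.sum_singleton] at h2
              exact pow_le_pow_left₀ (hG.nonneg hα hT ha y) h2 2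
      calc ∑ x ∈ latticeBall y R, u x ^ 2 ≤ T ^ 2 := h1
        _ ≤ (R ^ 2 / c₁ ^ 2) ^ 2 := by gcongr
        _ = 1 / c₁ ^ 4 * R ^ 2 * R ^ 2 := by ring
        _ ≤ 1 / c₁ ^ 4 * R ^ 2 * 1 := by
            gcongr
            exact pow_le_one₀ hR.le hlt.le
        _ ≤ (2 * D + 72 / c₁ ^ 4 + 1 / c₁ ^ 4) * R ^ 2 := by
            have : 0 ≤ (2 * D + 72 / c₁ ^ 4) * R ^ 2 := by positivity
            linarith
    · obtain ⟨c, hc0, hcT, hc⟩ := h β a ha T hT y u hG R hge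
      simp only [Real.rpow_two, sq_abs] at hc
      have hcard : ((latticeBall y R).card : ℝ) ≤ 9 * R ^ 2 := by
        calc ((latticeBall y R).card : ℝ) ≤ (2 * R + 1) ^ 2 := card_latticeBall_le y hR.le
          _ ≤ (3 * R) ^ 2 := by
              gcongr
              linarith
          _ = _ := by ring
      -- At the scale $R\sim\sqrt T$ the bound $cR^2\le2T$ makes the median itself bounded, so $u$
      -- and not merely $u-c$ is controlled.
      have hc' : c ≤ 2 / c₁ ^ 2 := by
        rw [le_div_iff₀ (by positivity)]
        have h1 : c * c₁ ^ 2 * R ^ 2 ≤ 2 * R ^ 2 := by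
          have := mul_le_mul_of_nonneg_left hcT (sq_nonneg c₁)
          linarith
        exact le_of_mul_le_mul_right h1 (by positivity)
      calc ∑ x ∈ latticeBall y R, u x ^ 2
          ≤ ∑ x ∈ latticeBall y R, (2 * (u x - c) ^ 2 + 2 * c ^ 2) :=
            Finset.sum_le_sum fun x _ => by nlinarith [sq_nonneg (u x - c - c)]
        _ = 2 * ∑ x ∈ latticeBall y R, (u x - c) ^ 2 + (latticeBall y R).card * (2 * c ^ 2) := by
            rw [Finset.sum_add_distrib, ← Finset.mul_sum, Finset.sum_const, nsmul_eq_mul]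
        _ ≤ 2 * (D * R ^ 2) + 9 * R ^ 2 * (2 * (2 / c₁ ^ 2) ^ 2) := by gcongr
        _ = (2 * D + 72 / c₁ ^ 4) * R ^ 2 := by ring
        _ ≤ _ := by
            have : 0 ≤ 1 / c₁ ^ 4 * R ^ 2 := by positivity
            linarith
  · intro q r hq hr
    obtain ⟨R₁, hR₁, h⟩ := exists_sum_latticeAnnulus_rpow_le_decay d hα hαβ hq hr
    refine ⟨R₁, hR₁, fun T₀ hT₀ => ?_⟩
    obtain ⟨C, hC, h⟩ := h T₀ hT₀
    exact ⟨C, hC, fun a ha T hT y R hTR hcase =>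
      h a ha T hT y _ (isGreenFunction_greenFunction hα hT ha y) R hTR hcase⟩
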